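/- A topological group $G$ is Polish if its topology is separable and completely metrizable; a Polish group is TSI if it admits a compatible two-sided invariant metric, and non-archimedean if its identity has a neighbourhood basis consisting of open subgroups. For equivalence relations $E,F$ on Polish spaces $X,Y$, write $E\le_B F$ if there is a Borel map $f:X\to Y$ with $x\,E\,y\iff f(x)\,F\,f(y)$ for all $x,y\in X$; write $E\sim_B F$ if $E\le_B F$ and $F\le_B E$; and write $E<_B F$ if $E\le_B F$ and $F\not\le_B E$. Let $E_0$ be the relation of eventual equality on $2^\omega$, let $E_0^\omega$ be the relation on $(2^\omega)^\omega$ given by $x\,E_0^\omega\,y\iff\forall n\,(x(n)\,E_0\,y(n))$, and let $\mathbb R^\omega/c_0$ be the relation on $\mathbb R^\omega$ under which $x,y$ are equivalent iff $\lim_n (x(n)-y(n))=0$. For a Polish group $G$, let $E(G)$ be the relation on $G^\omega$ given by $x\,E(G)\,y$ iff the sequence $x(n)y(n)^{-1}$ converges in $G$. **Theorem.** Let $G$ be a Polish group. Then the following are equivalent: 1. $G$ is TSI and non-archimedean; 2. $E(G)\le_B E_0^\omega$; 3. $E(G)\le_B \mathbb R^\omega/c_0$. Moreover, $E(G)\sim_B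 E_0^\omega$ if and only if $G$ is TSI, uncountable and non-archimedean. In particular, there is no Polish group $G$ such that $E_0^\omega <_B E(G)\le_B \mathbb R^\omega/c_0$. -/

import Mathlib

/-!
A Polish group is TSI and non-archimedean iff its open normal subgroups form a neighbourhood basis
of the identity. Given such a basis `N k`, normality and completeness of `G` for the two-sided
uniformity show that `x` and `y` are `E(G)`-equivalent iff the sequences `x(n+1)⁻¹ x(n)` and
`y(n+1)⁻¹ y(n)` eventually agree in each of the countable quotients `G ⧸ N k`, which reduces `E(G)`
to `E₀^ω`.

Conversely, let `θ` reduce the restriction of `E(G)` to `Λ^ω`, for a countable subgroup `Λ` of `G`,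
to `ℝ^ω/c₀`, and let `x` be a generic point. Eventually constant translations do not change the
class of `x`. For each `ε` there is a neighbourhood of the identity whose elements, multiplied in at
late indices, change `θ` by at most `ε`: otherwise too large changes would accumulate to a `y` that
is equivalent to `x` in `E(G)` while `θ y` and `θ x` are not equivalent. The same bound holds for
the conjugates of these elements, and finitely many such changes can be made at successive ranges of
indices, so they add up to a bounded but slow change of `θ`. Hence all elements of the normal
closure of the neighbourhood move `θ` slowly by about `ε`. As `ε → 0`, slow moves concatenate to a
point equivalent to `x`, so their product converges and the elements moved by are close to `1`. Thus
normal closures of small neighbourhoods are small.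

For uncountable `G`, letters `g k → 1` code `E₀^ω` in `E(G)`. For countable `G` the relation `E(G)`
is a countable union of closed sets, which Baire's theorem excludes for a relation above `E₀^ω`.
-/

open Filter Topology

/-- Borel reducibility `E ≤_B F` of equivalence relations on (Polish) topological spaces:
there is a Borel map `f : X → Y` with `x E y ↔ f x F f y`. -/
def BorelReducible {X Y : Type*} [TopologicalSpace X] [TopologicalSpace Y]
    (E : Setoid X) (F : Setoid Y) : Prop :=
  ∃ f : X → Y, @Measurable X Y (borel X) (borel Y) f ∧ ∀ x y : X, E x y ↔ F (f x) (f y)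

/-- `E ~_B F`. -/
def BorelBireducible {X Y : Type*} [TopologicalSpace X] [TopologicalSpace Y]
    (E : Setoid X) (F : Setoid Y) : Prop :=
  BorelReducible E F ∧ BorelReducible F E

/-- `E <_B F`. -/
def StrictlyBorelReducible {X Y : Type*} [TopologicalSpace X] [TopologicalSpace Y]
    (E : Setoid X) (F : Setoid Y) : Prop :=
  BorelReducible E F ∧ ¬ BorelReducible F E

/-- The relation `E₀` of eventual equality on `2^ω`. -/
def eqvE0 : Setoid (ℕ → Bool) where
  r x y := ∃ m : ℕ, ∀ n > m, x n = y n
  iseqv :=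
    { refl := fun _ => ⟨0, fun _ _ => rfl⟩
      symm := fun ⟨m, h⟩ => ⟨m, fun n hn => (h n hn).symm⟩
      trans := fun ⟨m, h⟩ ⟨k, h'⟩ => ⟨max m k, fun n hn =>
        (h n (lt_of_le_of_lt (le_max_left m k) hn)).trans
          (h' n (lt_of_le_of_lt (le_max_right m k) hn))⟩ }

/-- The relation `E^ω` on `X^ω`: coordinatewise `E`-equivalence. -/
def eqvOmega {X : Type*} (E : Setoid X) : Setoid (ℕ → X) where
  r x y := ∀ n : ℕ, E (x n) (y n)
  iseqv :=
    { refl := fun x n => E.refl (x n)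
      symm := fun h n => E.symm (h n)
      trans := fun h h' n => E.trans (h n) (h' n) }

/-- The relation `ℝ^ω / c₀` on `ℝ^ω`: the difference converges to `0`. -/
def eqvRc0 : Setoid (ℕ → ℝ) where
  r x y := Tendsto (fun n => x n - y n) atTop (𝓝 0)
  iseqv :=
    { refl := fun x => by simp
      symm := fun {x y} h => by simpa using h.neg
      trans := fun {x y z} h h' => by simpa using h.add h' }

/-- The equivalence relation `E(G)` on `G^ω`: the sequence `x(n) y(n)⁻¹` converges in `G`. -/
def eqvGroup (G : Type*) [Group G] [TopologicalSpace G] [IsTopologicalGroup G] :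
    Setoid (ℕ → G) where
  r x y := ∃ g : G, Tendsto (fun n => x n * (y n)⁻¹) atTop (𝓝 g)
  iseqv :=
    { refl := fun x => ⟨1, by simpa using tendsto_const_nhds⟩
      symm := fun {x y} ⟨g, h⟩ => ⟨g⁻¹, by simpa using h.inv⟩
      trans := fun {x y z} ⟨g, h⟩ ⟨k, h'⟩ => ⟨g * k, by simpa [mul_assoc] using h.mul h'⟩ }

/-- `G` is TSI: it admits a compatible two-sided invariant metric. -/
def IsTSI (G : Type*) [Group G] [τ : TopologicalSpace G] : Prop :=
  ∃ d : MetricSpace G, d.toUniformSpace.toTopologicalSpace = τ ∧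
    (∀ g h k : G, dist (g * h) (g * k) = dist h k) ∧
    (∀ g h k : G, dist (h * g) (k * g) = dist h k)

/-- The open normal subgroups of `G` form a neighbourhood basis of the identity. -/
def HasOpenNormalBasis (G : Type*) [Group G] [TopologicalSpace G] : Prop :=
  ∀ V ∈ 𝓝 (1 : G), ∃ N : OpenNormalSubgroup G, (N : Set G) ⊆ V

section OpenNormalBasis

variable {G : Type*} [Group G] [TopologicalSpace G]

theorem HasOpenNormalBasis.nonarchimedeanGroup [IsTopologicalGroup G]
    (h : HasOpenNormalBasis G) : NonarchimedeanGroup G where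
  is_nonarchimedean V hV :=
    let ⟨N, hN⟩ := h V hV
    ⟨N.toOpenSubgroup, hN⟩

theorem HasOpenNormalBasis.of_normalClosure_subset [SeparatelyContinuousMul G]
    (h : ∀ V ∈ 𝓝 (1 : G), ∃ U ∈ 𝓝 (1 : G), (Subgroup.normalClosure U : Set G) ⊆ V) :
    HasOpenNormalBasis G := by
  intro V hV
  obtain ⟨U, hU, hUV⟩ := h V hV
  exact ⟨{ toSubgroup := Subgroup.normalClosure U
           isOpen' := Subgroup.isOpen_of_mem_nhds _ (g := 1)
            (mem_of_superset hU Subgroup.subset_normalClosure) }, hUV⟩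

theorem IsTSI.exists_conj_mem (h : IsTSI G) {V : Set G} (hV : V ∈ 𝓝 (1 : G)) :
    ∃ B ∈ 𝓝 (1 : G), B ⊆ V ∧ ∀ b ∈ B, ∀ g : G, g * b * g⁻¹ ∈ B := by
  obtain ⟨d, rfl, dist_left, dist_right⟩ := h
  obtain ⟨r, r_pos, hrV⟩ := Metric.mem_nhds_iff.1 hV
  refine ⟨Metric.ball 1 r, Metric.ball_mem_nhds _ r_pos, hrV, fun b hb g => ?_⟩
  have dist_conj : dist (g * b * g⁻¹) (g * 1 * g⁻¹) = dist b 1 := by rw [dist_right, dist_left]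
  rw [mul_one, mul_inv_cancel] at dist_conj
  rwa [Metric.mem_ball, dist_conj]

theorem IsTSI.hasOpenNormalBasis [NonarchimedeanGroup G] (h : IsTSI G) :
    HasOpenNormalBasis G := by
  refine .of_normalClosure_subset fun V hV => ?_
  obtain ⟨H, hHV⟩ := NonarchimedeanGroup.is_nonarchimedean V hV
  obtain ⟨B, hB, hBH, hconj⟩ := h.exists_conj_mem H.mem_nhds_one
  have conjugates_subset : Group.conjugatesOfSet B ⊆ H := by
    intro y hy
    obtain ⟨b, hb, hby⟩ := Group.mem_conjugatesOfSet_iff.1 hy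
    obtain ⟨g, rfl⟩ := isConj_iff.1 hby
    exact hBH (hconj b hb g)
  have closure_le : Subgroup.normalClosure B ≤ H.toSubgroup :=
    (Subgroup.closure_le _).2 conjugates_subset
  exact ⟨B, hB, fun x hx => hHV (closure_le hx)⟩

theorem HasOpenNormalBasis.exists_hasBasis [FirstCountableTopology G]
    (h : HasOpenNormalBasis G) :
    ∃ N : ℕ → OpenNormalSubgroup G,
      (𝓝 (1 : G)).HasBasis (fun _ => True) fun k => (N k : Set G) := by
  obtain ⟨V, hV⟩ := (𝓝 (1 : G)).exists_antitone_basis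
  choose N hN using fun k => h (V k) (hV.1.mem_of_mem trivial)
  refine ⟨N, hasBasis_iff.2 fun t => ⟨fun ht => ?_, fun ⟨k, _, hk⟩ => ?_⟩⟩
  · obtain ⟨k, -, hk⟩ := hV.1.mem_iff.1 ht
    exact ⟨k, trivial, (hN k).trans hk⟩
  · exact mem_of_superset (N k).toOpenSubgroup.mem_nhds_one hk

theorem piNat_dist_congr {E : ℕ → Type*} {x y x' y' : ∀ n, E n}
    (h : ∀ n, x n = y n ↔ x' n = y' n) :
    (PiNat.dist (E := E)).dist x y = PiNat.dist.dist x' y' := by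
  classical
  have h_eq : x = y ↔ x' = y' := by simp only [funext_iff, h]
  obtain rfl | hne := eq_or_ne x y
  · rw [h_eq.1 rfl, PiNat.dist_self, PiNat.dist_self]
  · have hne' : x' ≠ y' := mt h_eq.2 hne
    have h_firstDiff : PiNat.firstDiff x y = PiNat.firstDiff x' y' := by
      rw [PiNat.firstDiff_def, PiNat.firstDiff_def, dif_pos hne, dif_pos hne']
      exact Nat.find_congr' (h _).not
    rw [PiNat.dist_eq_of_ne hne, PiNat.dist_eq_of_ne hne', h_firstDiff]

/-- The homomorphism to `∏ₖ G ⧸ N k` whose pullback of the first-difference metric witnesses that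
`G` is TSI. -/
abbrev quotientProductHom (N : ℕ → OpenNormalSubgroup G) : G →* ∀ k, G ⧸ (N k).toSubgroup :=
  MonoidHom.pi fun k => QuotientGroup.mk' (N k).toSubgroup

theorem isInducing_quotientProductHom [IsTopologicalGroup G] {N : ℕ → OpenNormalSubgroup G}
    (hN : (𝓝 (1 : G)).HasBasis (fun _ => True) fun k => (N k : Set G)) :
    IsInducing (quotientProductHom N) := by
  refine IsTopologicalGroup.isInducing_iff_nhds_one.2 (le_antisymm ?_ fun V hV => ?_)
  · have h_cont : Continuous (quotientProductHom N) := continuous_pi fun k => continuous_quot_mk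
    simpa using (h_cont.tendsto 1).le_comap
  · obtain ⟨k, -, hk⟩ := hN.mem_iff.1 hV
    have h_disc : DiscreteTopology (G ⧸ (N k).toSubgroup) :=
      QuotientGroup.discreteTopology (N k).isOpen'
    refine mem_comap.2 ⟨{z | z k = 1}, ?_, fun x hx => hk ?_⟩
    · exact (continuous_apply k).continuousAt.preimage_mem_nhds
        ((isOpen_discrete {1}).mem_nhds rfl)
    · exact (QuotientGroup.eq_one_iff x).1 hx

theorem HasOpenNormalBasis.isTSI [IsTopologicalGroup G] [FirstCountableTopology G] [T0Space G]
    (h : HasOpenNormalBasis G) : IsTSI G := by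
  obtain ⟨N, hN⟩ := h.exists_hasBasis
  have h_disc (k) : DiscreteTopology (G ⧸ (N k).toSubgroup) :=
    QuotientGroup.discreteTopology (N k).isOpen'
  have h_ind := isInducing_quotientProductHom hN
  refine ⟨.induced (quotientProductHom N) h_ind.injective PiNat.metricSpace,
    h_ind.eq_induced.symm, fun g h k => piNat_dist_congr fun n => ?_,
    fun g h k => piNat_dist_congr fun n => ?_⟩
  · simp only [map_mul, Pi.mul_apply, mul_right_inj]
  · simp only [map_mul, Pi.mul_apply, mul_left_inj]

theorem hasOpenNormalBasis_iff [IsTopologicalGroup G] [FirstCountableTopology G] [T0Space G] :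
    HasOpenNormalBasis G ↔ IsTSI G ∧ NonarchimedeanGroup G :=
  ⟨fun h => ⟨h.isTSI, h.nonarchimedeanGroup⟩, fun ⟨h, _⟩ => h.hasOpenNormalBasis⟩

end OpenNormalBasis

section Reducibility

theorem measurable_borel_of_continuous {X Y : Type*} [TopologicalSpace X] [TopologicalSpace Y]
    {f : X → Y} (hf : Continuous f) : @Measurable X Y (borel X) (borel Y) f := by
  borelize X Y
  exact hf.measurable

theorem BorelReducible.trans {X Y Z : Type*} [TopologicalSpace X] [TopologicalSpace Y]
    [TopologicalSpace Z] {E : Setoid X} {F : Setoid Y} {H : Setoid Z}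
    (hEF : BorelReducible E F) (hFH : BorelReducible F H) : BorelReducible E H := by
  obtain ⟨f, f_meas, hf⟩ := hEF
  obtain ⟨g, g_meas, hg⟩ := hFH
  borelize X Y Z
  exact ⟨g ∘ f, g_meas.comp f_meas, fun x y => (hf x y).trans (hg _ _)⟩

theorem BorelReducible.eqvOmega_mono {X Y : Type*} [TopologicalSpace X] [TopologicalSpace Y]
    [SecondCountableTopology Y] {E : Setoid X} {F : Setoid Y} (h : BorelReducible E F) :
    BorelReducible (eqvOmega E) (eqvOmega F) := by
  obtain ⟨f, f_meas, hf⟩ := h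
  refine ⟨fun x n => f (x n), ?_, fun x y => forall_congr' fun n => hf _ _⟩
  borelize Y (ℕ → X)
  rw [← (Pi.borelSpace (X := fun _ : ℕ => Y)).measurable_eq]
  exact measurable_pi_lambda _ fun n =>
    f_meas.comp (measurable_borel_of_continuous (continuous_apply n))

theorem eqvE0_iff {x y : ℕ → Bool} : eqvE0 x y ↔ ∀ᶠ n in atTop, x n = y n := by
  simp only [atTop_basis_Ioi.eventually_iff, true_and, Set.mem_Ioi]
  rfl

theorem borelReducible_germSetoid_eqvE0 {D : Type*} [Countable D] [TopologicalSpace D]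
    [DiscreteTopology D] : BorelReducible (germSetoid (atTop : Filter ℕ) D) eqvE0 := by
  obtain ⟨c, hc⟩ := exists_injective_nat D
  let graph (x : ℕ → D) (p : ℕ) : Bool := decide (c (x p.unpair.1) = p.unpair.2)
  refine ⟨graph, measurable_borel_of_continuous ?_, fun x y => ?_⟩
  · exact continuous_pi fun p =>
      (continuous_of_discreteTopology (f := fun d => decide (c d = p.unpair.2))).comp
        (continuous_apply p.unpair.1)
  rw [eqvE0_iff]
  constructor <;> intro h
  · have h_fin : {n | x n ≠ y n}.Finite := by
      rw [← eventually_cofinite, Nat.cofinite_eq_atTop]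
      exact h
    rw [← Nat.cofinite_eq_atTop, eventually_cofinite]
    refine ((h_fin.image fun n => Nat.pair n (c (x n))).union
      (h_fin.image fun n => Nat.pair n (c (y n)))).subset fun p hp => ?_
    obtain ⟨⟨n, m⟩, rfl⟩ := Nat.pairEquiv.surjective p
    simp only [graph, Nat.pairEquiv_apply, Function.uncurry_apply_pair, Nat.unpair_pair,
      Set.mem_ofPred_eq, decide_eq_decide] at hp
    have hxy : x n ≠ y n := fun e => hp (by rw [e])
    by_cases hm : c (x n) = m
    · exact .inl ⟨n, hxy, by simp [hm]⟩
    · exact .inr ⟨n, hxy, by simp [show c (y n) = m by tauto]⟩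
  · have h_code : Tendsto (fun n => Nat.pair n (c (x n))) atTop atTop :=
      tendsto_atTop_mono (fun n => Nat.left_le_pair n _) tendsto_id
    filter_upwards [h_code.eventually h] with n hn
    exact hc (Eq.symm (by simpa [graph] using hn))

end Reducibility

section TwoSidedCauchy

variable {G : Type*} [Group G] [TopologicalSpace G] [IsTopologicalGroup G]
  {ι : Type*} {f : Filter ι} [NeBot f] {w : ι → G}

theorem dense_setOf_eventually_mul_mem
    (h_left : Tendsto (fun p : ι × ι => (w p.1)⁻¹ * w p.2) (f ×ˢ f) (𝓝 1))
    (h_right : Tendsto (fun p : ι × ι => w p.1 * (w p.2)⁻¹) (f ×ˢ f) (𝓝 1))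
    {U : G → Set G} (hU : ∀ c, U c ∈ 𝓝 c) :
    Dense {h | ∃ c, ∀ᶠ p in f ×ˢ 𝓝 h, w p.1 * p.2 ∈ U c} := by
  refine dense_iff_inter_open.2 fun O hO ⟨g, hg⟩ => ?_
  have h_near_g : Tendsto (fun p : ι × ι => (w p.2)⁻¹ * w p.1 * g) (f ×ˢ f) (𝓝 g) := by
    simpa using (h_left.comp tendsto_prod_swap).mul_const g
  obtain ⟨m₀, hm₀⟩ := (h_near_g.eventually (hO.mem_nhds hg)).curry.exists
  set c := w m₀ * g
  have h_mul : Tendsto (fun q : G × G => q.1 * c * q.2) (𝓝 1 ×ˢ 𝓝 1) (𝓝 c) := by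
    have h_cont : Continuous fun q : G × G => q.1 * c * q.2 := by fun_prop
    simpa [nhds_prod_eq] using h_cont.tendsto (1, 1)
  obtain ⟨V, hV, W, hW, hVW⟩ := mem_prod_iff.1 (h_mul (hU c))
  have h_right' := (h_right.comp tendsto_prod_swap).eventually hV
  obtain ⟨m, hm, hmV⟩ := (hm₀.and h_right'.curry).exists
  -- `wₙ h = (wₙ wₘ⁻¹) c (h₀⁻¹ h)` for `h₀ = wₘ⁻¹ c`.
  set h₀ := (w m)⁻¹ * c with h₀_def
  have h_near_h₀ : ∀ᶠ h in 𝓝 h₀, h₀⁻¹ * h ∈ W :=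
    (continuous_const_mul h₀⁻¹).continuousAt.preimage_mem_nhds (by simpa using hW)
  have h₀_mem : h₀ ∈ O := by rw [h₀_def, ← mul_assoc]; exact hm
  refine ⟨h₀, h₀_mem, c, ?_⟩
  filter_upwards [hmV.prod_mk h_near_h₀] with ⟨n, h⟩ ⟨hn, hh⟩
  have := hVW (Set.mk_mem_prod hn hh)
  simpa [h₀_def, mul_assoc] using this

/-- By Baire's theorem, `wₙ g` is Cauchy for a complete metric when `g` is generic. -/
theorem exists_tendsto_of_tendsto_inv_mul_of_tendsto_mul_inv
    [TopologicalSpace.IsCompletelyMetrizableSpace G]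
    (h_left : Tendsto (fun p : ι × ι => (w p.1)⁻¹ * w p.2) (f ×ˢ f) (𝓝 1))
    (h_right : Tendsto (fun p : ι × ι => w p.1 * (w p.2)⁻¹) (f ×ˢ f) (𝓝 1)) :
    ∃ g, Tendsto w f (𝓝 g) := by
  let _ := TopologicalSpace.upgradeIsCompletelyMetrizable G
  let A (k : ℕ) : Set G := {h | ∃ c, ∀ᶠ p in f ×ˢ 𝓝 h, w p.1 * p.2 ∈ Metric.ball c (1 / (k + 1))}
  have A_open (k) : IsOpen (A k) := by
    refine isOpen_iff_mem_nhds.2 fun h ⟨c, hc⟩ => ?_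
    obtain ⟨S, hS, T, hT, hST⟩ := mem_prod_iff.1 hc
    filter_upwards [eventually_mem_nhds_iff.2 hT] with h' hh'
    exact ⟨c, mem_of_superset (prod_mem_prod hS hh') hST⟩
  have A_dense (k) : Dense (A k) :=
    dense_setOf_eventually_mul_mem h_left h_right fun c => Metric.ball_mem_nhds c (by positivity)
  obtain ⟨g, hg⟩ := (dense_iInter_of_isOpen A_open A_dense).nonempty
  have h_cauchy : Cauchy (map (fun n => w n * g) f) := by
    refine Metric.cauchy_iff.2 ⟨inferInstance, fun ε hε => ?_⟩
    obtain ⟨k, hk⟩ := exists_nat_one_div_lt (half_pos hε)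
    obtain ⟨c, hc⟩ := Set.mem_iInter.1 hg k
    refine ⟨Metric.ball c (1 / (k + 1)), ?_, fun x hx y hy => ?_⟩
    · exact mem_map.2 (hc.curry.mono fun n hn => hn.self_of_nhds)
    · linarith [dist_triangle_right x y c, Metric.mem_ball.1 hx, Metric.mem_ball.1 hy]
  obtain ⟨l, hl⟩ := CompleteSpace.complete h_cauchy
  exact ⟨l * g⁻¹, by simpa using Tendsto.mul_const g⁻¹ (show Tendsto _ f (𝓝 l) from hl)⟩

end TwoSidedCauchy

theorem inv_mul_mem_of_forall_succ {G : Type*} [Group G] (H : Subgroup G) {w : ℕ → G} {m n : ℕ}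
    (hmn : m ≤ n) (h : ∀ i ≥ m, (w (i + 1))⁻¹ * w i ∈ H) : (w n)⁻¹ * w m ∈ H := by
  induction n, hmn using Nat.le_induction with
  | base => simp
  | succ n hmn ih => simpa [mul_assoc] using H.mul_mem (h n hmn) ih

section OpenNormalBasisReduction

variable {G : Type*} [Group G] [TopologicalSpace G] [IsTopologicalGroup G]

theorem exists_tendsto_iff_of_hasBasis [TopologicalSpace.IsCompletelyMetrizableSpace G]
    {N : ℕ → OpenNormalSubgroup G}
    (hN : (𝓝 (1 : G)).HasBasis (fun _ => True) fun k => (N k : Set G)) {w : ℕ → G} :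
    (∃ g, Tendsto w atTop (𝓝 g)) ↔ ∀ k, ∀ᶠ n in atTop, (w (n + 1))⁻¹ * w n ∈ (N k).toSubgroup := by
  constructor
  · rintro ⟨g, hg⟩ k
    have h_step : Tendsto (fun n => (w (n + 1))⁻¹ * w n) atTop (𝓝 1) := by
      simpa using (hg.comp (tendsto_add_atTop_nat 1)).inv.mul hg
    exact h_step.eventually (hN.mem_of_mem trivial)
  · intro h
    have h_tail (k) : ∀ᶠ p : ℕ × ℕ in atTop ×ˢ atTop, (w p.1)⁻¹ * w p.2 ∈ (N k).toSubgroup := by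
      obtain ⟨m, hm⟩ := eventually_atTop.1 (h k)
      have hge := fun {n} hn => inv_mul_mem_of_forall_succ (N k).toSubgroup (n := n) hn hm
      filter_upwards [(eventually_ge_atTop m).prod_mk (eventually_ge_atTop m)] with p hp
      simpa using (N k).toSubgroup.mul_mem (hge hp.1) (inv_mem (hge hp.2))
    refine exists_tendsto_of_tendsto_inv_mul_of_tendsto_mul_inv
      (hN.tendsto_right_iff.2 fun k _ => h_tail k) (hN.tendsto_right_iff.2 fun k _ => ?_)
    filter_upwards [tendsto_prod_swap.eventually (h_tail k)] with p hp
    exact (N k).isNormal'.mem_comm hp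

theorem eqvGroup_iff_of_hasBasis [TopologicalSpace.IsCompletelyMetrizableSpace G]
    {N : ℕ → OpenNormalSubgroup G}
    (hN : (𝓝 (1 : G)).HasBasis (fun _ => True) fun k => (N k : Set G)) {x y : ℕ → G} :
    eqvGroup G x y ↔ ∀ k, ∀ᶠ n in atTop, (((x (n + 1))⁻¹ * x n : G) : G ⧸ (N k).toSubgroup) =
      ((y (n + 1))⁻¹ * y n : G) := by
  refine (exists_tendsto_iff_of_hasBasis hN).trans
    (forall_congr' fun k => eventually_congr (.of_forall fun n => ?_))
  have h_conj := (N k).isNormal'.mem_comm_iff (a := y (n + 1)) (b := (x (n + 1))⁻¹ * x n * (y n)⁻¹)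
  rw [QuotientGroup.eq_iff_div_mem]
  simpa [mul_assoc, div_eq_mul_inv] using h_conj

theorem HasOpenNormalBasis.borelReducible_eqvOmega_eqvE0 [PolishSpace G]
    (h : HasOpenNormalBasis G) : BorelReducible (eqvGroup G) (eqvOmega eqvE0) := by
  obtain ⟨N, hN⟩ := h.exists_hasBasis
  have h_countable (k) : Countable (G ⧸ (N k).toSubgroup) := by
    have := QuotientGroup.discreteTopology (N k).isOpen'
    exact TopologicalSpace.separableSpace_iff_countable.1 inferInstance
  choose code h_code using fun k => exists_injective_nat (G ⧸ (N k).toSubgroup)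
  have h_reducible : BorelReducible (eqvGroup G) (eqvOmega (germSetoid (atTop : Filter ℕ) ℕ)) := by
    refine ⟨fun x k n => code k ((x (n + 1))⁻¹ * x n : G), measurable_borel_of_continuous ?_,
      fun x y => ?_⟩
    · refine continuous_pi fun k => continuous_pi fun n => ?_
      have := QuotientGroup.discreteTopology (N k).isOpen'
      exact (continuous_of_discreteTopology (f := code k)).comp
        (QuotientGroup.continuous_mk.comp (by fun_prop))
    · rw [eqvGroup_iff_of_hasBasis hN]
      exact forall_congr' fun k => eventually_congr (.of_forall fun n => (h_code k).eq_iff.symm)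
  exact h_reducible.trans borelReducible_germSetoid_eqvE0.eqvOmega_mono

end OpenNormalBasisReduction

section BlockCode

theorem tendsto_iff_forall_tendsto_pair {Y : Type*} {l : Filter Y} {w : ℕ → Y}
    (h : ∀ V ∈ l, ∀ᶠ k in atTop, ∀ m, w (Nat.pair k m) ∈ V) :
    Tendsto w atTop l ↔ ∀ k, Tendsto (fun m => w (Nat.pair k m)) atTop l := by
  have h_pair (k) : Tendsto (Nat.pair k) atTop atTop :=
    tendsto_atTop_mono (fun m => Nat.right_le_pair k m) tendsto_id
  refine ⟨fun hw k => hw.comp (h_pair k), fun hw V hV => ?_⟩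
  obtain ⟨K, hK⟩ := eventually_atTop.1 (h V hV)
  have h_finite (k) : {m | w (Nat.pair k m) ∉ V}.Finite := by
    have := (hw k).eventually hV
    rwa [← Nat.cofinite_eq_atTop, eventually_cofinite] at this
  rw [mem_map, ← Nat.cofinite_eq_atTop, mem_cofinite]
  refine ((Set.finite_lt_nat K).biUnion fun k _ => (h_finite k).image (Nat.pair k)).subset ?_
  intro p hp
  obtain ⟨⟨k, m⟩, rfl⟩ := Nat.pairEquiv.surjective p
  have hkK : k < K := not_le.1 fun hk => hp (hK k hk m)
  exact Set.mem_biUnion hkK ⟨m, hp, rfl⟩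

variable {G : Type*} [Group G]

/-- The sequence over `G` coding `x : ℕ → 2^ω`: its restriction to the `k`-th block
`{Nat.pair k m | m}` is `x k` written in the letters `1` and `g k`. -/
@[to_additive]
def mulBlockCode (g : ℕ → G) (x : ℕ → ℕ → Bool) (p : ℕ) : G :=
  if x p.unpair.1 p.unpair.2 then g p.unpair.1 else 1

@[to_additive]
theorem continuous_mulBlockCode [TopologicalSpace G] (g : ℕ → G) :
    Continuous (mulBlockCode g) :=
  continuous_pi fun p =>
    (continuous_of_discreteTopology (f := fun b : Bool => if b then g p.unpair.1 else 1)).comp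
      (by fun_prop : Continuous fun x : ℕ → ℕ → Bool => x p.unpair.1 p.unpair.2)

@[to_additive]
theorem mulBlockCode_pair_div (g : ℕ → G) (x y : ℕ → ℕ → Bool) (k m : ℕ) :
    mulBlockCode g x (Nat.pair k m) / mulBlockCode g y (Nat.pair k m) =
      if x k m = y k m then 1 else if x k m then g k else (g k)⁻¹ := by
  cases hx : x k m <;> cases hy : y k m <;> simp [mulBlockCode, hx, hy]

variable [TopologicalSpace G] [IsTopologicalGroup G] {g : ℕ → G}

@[to_additive]
theorem eventually_forall_mulBlockCode_div_mem (hg : Tendsto g atTop (𝓝 1))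
    (x y : ℕ → ℕ → Bool) {V : Set G} (hV : V ∈ 𝓝 1) :
    ∀ᶠ k in atTop, ∀ m,
      mulBlockCode g x (Nat.pair k m) / mulBlockCode g y (Nat.pair k m) ∈ V := by
  have hg_inv : Tendsto (fun k => (g k)⁻¹) atTop (𝓝 1) := by simpa using hg.inv
  filter_upwards [hg.eventually_mem hV, hg_inv.eventually_mem hV] with k hk hk_inv m
  rw [mulBlockCode_pair_div]
  split_ifs
  exacts [mem_of_mem_nhds hV, hk, hk_inv]

@[to_additive]
theorem tendsto_mulBlockCode_div_iff [T1Space G] (hg : Tendsto g atTop (𝓝 1))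
    (hg_ne : ∀ k, g k ≠ 1) {x y : ℕ → ℕ → Bool} :
    Tendsto (fun p => mulBlockCode g x p / mulBlockCode g y p) atTop (𝓝 1) ↔
      eqvOmega eqvE0 x y := by
  rw [tendsto_iff_forall_tendsto_pair fun V => eventually_forall_mulBlockCode_div_mem hg x y]
  refine forall_congr' fun k => ?_
  rw [eqvE0_iff]
  simp only [mulBlockCode_pair_div]
  constructor <;> intro h
  · have h_mem : ({g k, (g k)⁻¹} : Set G)ᶜ ∈ 𝓝 1 :=
      (Set.toFinite {g k, (g k)⁻¹}).isClosed.isOpen_compl.mem_nhds (by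
        simpa [eq_comm] using hg_ne k)
    filter_upwards [h.eventually_mem h_mem] with m hm
    by_contra hxy
    rw [if_neg hxy] at hm
    split_ifs at hm <;> simp at hm
  · exact tendsto_const_nhds.congr' (h.mono fun m hm => (if_pos hm).symm)

theorem borelReducible_eqvOmega_eqvE0_eqvRc0 : BorelReducible (eqvOmega eqvE0) eqvRc0 := by
  have h_tendsto : Tendsto (fun k : ℕ => (1 / 2 : ℝ) ^ k) atTop (𝓝 0) :=
    tendsto_pow_atTop_nhds_zero_of_lt_one (by norm_num) (by norm_num)
  exact ⟨_, measurable_borel_of_continuous (continuous_addBlockCode _), fun x y =>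
    (tendsto_addBlockCode_sub_iff h_tendsto fun k => by positivity).symm⟩

theorem borelReducible_eqvOmega_eqvE0_eqvGroup [T2Space G] (hg : Tendsto g atTop (𝓝 1))
    (hg_ne : ∀ k, g k ≠ 1) : BorelReducible (eqvOmega eqvE0) (eqvGroup G) := by
  refine ⟨_, measurable_borel_of_continuous (continuous_mulBlockCode g), fun x y => ?_⟩
  rw [← tendsto_mulBlockCode_div_iff hg hg_ne]
  simp only [div_eq_mul_inv]
  refine ⟨fun h => ⟨1, h⟩, fun ⟨a, ha⟩ => ?_⟩
  have h_pair : Tendsto (fun k => Nat.pair k 0) atTop atTop :=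
    tendsto_atTop_mono (fun k => Nat.left_le_pair k 0) tendsto_id
  have h_one : Tendsto (fun k => mulBlockCode g x (Nat.pair k 0) *
      (mulBlockCode g y (Nat.pair k 0))⁻¹) atTop (𝓝 1) := fun V hV =>
    (eventually_forall_mulBlockCode_div_mem hg x y hV).mono fun k hk => by
      simpa only [div_eq_mul_inv] using hk 0
  rwa [tendsto_nhds_unique (ha.comp h_pair) h_one] at ha

theorem borelReducible_eqvOmega_eqvE0_eqvGroup_of_uncountable [PolishSpace G] [Uncountable G] :
    BorelReducible (eqvOmega eqvE0) (eqvGroup G) := by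
  have h_neBot : NeBot (𝓝[≠] (1 : G)) := by
    by_contra h
    have h_discrete : DiscreteTopology G :=
      discreteTopology_of_isOpen_singleton_one ((isOpen_singleton_iff_punctured_nhds 1).2
        (not_neBot.1 h))
    have h_countable : Countable G := TopologicalSpace.separableSpace_iff_countable.1 inferInstance
    exact not_countable h_countable
  obtain ⟨g, hg⟩ := exists_seq_tendsto (𝓝[≠] (1 : G))
  obtain ⟨hg, hg_ne⟩ := tendsto_nhdsWithin_iff.1 hg
  obtain ⟨K, hK⟩ := eventually_atTop.1 hg_ne
  exact borelReducible_eqvOmega_eqvE0_eqvGroup (hg.comp (tendsto_add_atTop_nat K))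
    fun k => hK _ (Nat.le_add_left K k)

end BlockCode

section Generic

variable {X : Type*} [TopologicalSpace X] [BaireSpace X]

theorem exists_isGδ_dense_forall_mem_nhdsWithin [MeasurableSpace X] [BorelSpace X] {ι : Type*}
    [Countable ι] {A : ι → Set X} (hA : ∀ i, MeasurableSet (A i)) :
    ∃ C : Set X, IsGδ C ∧ Dense C ∧ ∀ i, ∀ z ∈ C, z ∈ A i → A i ∈ 𝓝[C] z := by
  choose U hU hAU using fun i => (hA i).residualEq_isOpen
  have h_residual : ∀ᶠ z in residual X, ∀ i, z ∈ A i ↔ z ∈ U i :=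
    eventually_countable_forall.2 fun i => (hAU i).mem_iff
  obtain ⟨C, hC, hCG, hCd⟩ := mem_residual.1 h_residual
  refine ⟨C, hCG, hCd, fun i z hz hzA => mem_nhdsWithin.2 ⟨U i, hU i, (hC hz i).1 hzA, ?_⟩⟩
  exact fun w hw => (hC hw.2 i).2 hw.1

theorem exists_isGδ_dense_continuousOn [MeasurableSpace X] [BorelSpace X] {Y : Type*}
    [TopologicalSpace Y] [SecondCountableTopology Y] [MeasurableSpace Y] [OpensMeasurableSpace Y]
    {f : X → Y} (hf : Measurable f) : ∃ C : Set X, IsGδ C ∧ Dense C ∧ ContinuousOn f C := by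
  let B := TopologicalSpace.countableBasis Y
  obtain ⟨C, hCG, hCd, hC⟩ := exists_isGδ_dense_forall_mem_nhdsWithin (A := fun V : B => f ⁻¹' V)
    fun V => hf (TopologicalSpace.isOpen_of_mem_countableBasis V.2).measurableSet
  refine ⟨C, hCG, hCd, fun z hz => ?_⟩
  refine (TopologicalSpace.isBasis_countableBasis Y).nhds_hasBasis.tendsto_right_iff.2
    fun V ⟨hV, hzV⟩ => hC ⟨V, hV⟩ z hz hzV

theorem exists_forall_apply_mem_of_dense_isGδ [Nonempty X] {Γ : Type*} [Countable Γ]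
    (h : Γ → X ≃ₜ X) {C : Set X} (hCG : IsGδ C) (hCd : Dense C) : ∃ x, ∀ γ, h γ x ∈ C :=
  (dense_iInter_of_Gδ (fun γ => hCG.preimage (h γ).continuous)
    fun γ => hCd.preimage (h γ).isOpenMap).nonempty.imp fun _ => Set.mem_iInter.1

theorem eventually_forall_eq_of_lt_imp_mem {E : ℕ → Type*} [∀ i, TopologicalSpace (E i)]
    {v : ∀ i, E i} {U : Set (∀ i, E i)} (hU : U ∈ 𝓝 v) :
    ∀ᶠ M in atTop, ∀ w : ∀ i, E i, (∀ i < M, w i = v i) → w ∈ U := by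
  obtain ⟨I, hI, t, ht, htU⟩ := mem_pi.1 (nhds_pi (a := v) ▸ hU)
  filter_upwards [(eventually_all_finite hI).2 fun i _ => eventually_gt_atTop i] with M hM w hw
  exact htU fun i hi => hw i (hM i hi) ▸ mem_of_mem_nhds (ht i)

end Generic

section ClosedCover

open scoped symmDiff

/-- The homeomorphism of `(2^ω)^ω` flipping the entries in `s`. -/
def flipHomeomorph (s : ℕ → ℕ → Bool) : (ℕ → ℕ → Bool) ≃ₜ (ℕ → ℕ → Bool) :=
  have h_cont : Continuous fun x : ℕ → ℕ → Bool => s ∆ x :=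
    continuous_pi fun i => continuous_pi fun m =>
      (continuous_of_discreteTopology (f := fun b : Bool => s i m ∆ b)).comp
        (by fun_prop : Continuous fun x : ℕ → ℕ → Bool => x i m)
  { (symmDiff_right_involutive s).toPerm with
    continuous_toFun := h_cont
    continuous_invFun := h_cont }

/-- The set of entries whose `i`-th column is all of `ω` if `i ∈ o`, and is the finite set with
binary code `γ i` otherwise. -/
def columns (γ : ℕ → ℕ) (o : Option ℕ) : ℕ → ℕ → Bool :=
  fun i m => decide (i ∈ o) || (γ i).testBit m

theorem continuous_columns_none_symmDiff (x : ℕ → ℕ → Bool) :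
    Continuous fun γ : ℕ → ℕ => columns γ none ∆ x :=
  continuous_pi fun i => continuous_pi fun m =>
    (continuous_of_discreteTopology (f := fun c : ℕ => columns (fun _ => c) none i m ∆ x i m)).comp
      (continuous_apply i)

theorem tendsto_columns_update (γ : ℕ → ℕ) (k : ℕ) :
    Tendsto (fun n => columns (Function.update γ k (2 ^ n - 1)) none) atTop
      (𝓝 (columns γ (some k))) := by
  refine tendsto_pi_nhds.2 fun i => tendsto_pi_nhds.2 fun m => tendsto_const_nhds.congr' ?_
  filter_upwards [eventually_gt_atTop m] with n hn
  obtain rfl | hi := eq_or_ne i k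
  · simp [columns, Nat.testBit_two_pow_sub_one, hn]
  · simp [columns, hi, hi.symm]

theorem dense_range_finsupp : Dense (Set.range fun F : ℕ →₀ ℕ => (F : ℕ → ℕ)) := by
  intro γ
  refine mem_closure_of_tendsto (b := atTop)
    (f := fun n => Finsupp.indicator (Finset.range n) fun i _ => γ i) ?_
    (.of_forall fun n => ⟨_, rfl⟩)
  refine tendsto_pi_nhds.2 fun i => tendsto_const_nhds.congr' ?_
  filter_upwards [eventually_gt_atTop i] with n hn
  simp [Finsupp.indicator_apply, hn]

theorem eqvOmega_eqvE0_columns_none (γ : ℕ → ℕ) (x : ℕ → ℕ → Bool) :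
    eqvOmega eqvE0 x (columns γ none ∆ x) := by
  intro i
  rw [eqvE0_iff]
  filter_upwards [eventually_ge_atTop (γ i)] with m hm
  have : (γ i).testBit m = false :=
    Nat.testBit_lt_two_pow (hm.trans_lt Nat.lt_two_pow_self)
  simp [columns, this]

theorem not_eqvOmega_eqvE0_columns_some (γ : ℕ → ℕ) (k : ℕ) (x : ℕ → ℕ → Bool) :
    ¬ eqvOmega eqvE0 x (columns γ (some k) ∆ x) := by
  intro h
  obtain ⟨m, hm⟩ := (eqvE0_iff.1 (h k)).exists
  simp [columns] at hm

/-- By Baire's theorem in the orbit of `x`, one of the closed sets catches a somewhere dense set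
of flips. -/
theorem exists_nhds_subset_closure_of_cover {C : Set (ℕ → ℕ → Bool)} {x : ℕ → ℕ → Bool}
    (hC : IsGδ C)
    (hx : ∀ (F : ℕ →₀ ℕ) (o : Option ℕ), columns F o ∆ x ∈ C) {K : ℕ → Set (ℕ → ℕ → Bool)}
    (hK : ∀ γ : ℕ → ℕ, columns γ none ∆ x ∈ C → ∃ m, columns γ none ∆ x ∈ K m) :
    ∃ m, ∃ F : ℕ →₀ ℕ, closure {γ | columns γ none ∆ x ∈ C ∩ K m} ∈ 𝓝 (F : ℕ → ℕ) := by
  have h_residual : {γ : ℕ → ℕ | columns γ none ∆ x ∈ C} ∈ residual (ℕ → ℕ) :=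
    residual_of_dense_Gδ (hC.preimage (continuous_columns_none_symmDiff x))
      (dense_range_finsupp.mono (Set.range_subset_iff.2 fun F => hx F none))
  have h_cover : {γ : ℕ → ℕ | columns γ none ∆ x ∈ C} ⊆
      ⋃ m, {γ | columns γ none ∆ x ∈ C ∩ K m} := fun γ hγ =>
    Set.mem_iUnion.2 ((hK γ hγ).imp fun m hm => ⟨hγ, hm⟩)
  have h_nonmeagre : ¬ IsMeagre (⋃ m, {γ : ℕ → ℕ | columns γ none ∆ x ∈ C ∩ K m}) :=
    not_isMeagre_of_mem_residual (mem_of_superset h_residual h_cover)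
  obtain ⟨m, hm⟩ : ∃ m, ¬ IsNowhereDense {γ : ℕ → ℕ | columns γ none ∆ x ∈ C ∩ K m} := by
    by_contra! h
    exact h_nonmeagre (isMeagre_iUnion fun m => (h m).isMeagre)
  obtain ⟨_, hF, F, rfl⟩ := dense_range_finsupp.inter_open_nonempty _ isOpen_interior
    (Set.nonempty_iff_ne_empty.2 hm)
  exact ⟨m, F, mem_interior_iff_mem_nhds.1 hF⟩

theorem exists_columns_some_mem_closure {S : Set (ℕ → ℕ → Bool)} {x : ℕ → ℕ → Bool}
    {γ : ℕ → ℕ} (hγ : closure {γ | columns γ none ∆ x ∈ S} ∈ 𝓝 γ) :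
    ∃ k, columns γ (some k) ∆ x ∈ closure S := by
  obtain ⟨k, hk⟩ := (eventually_forall_eq_of_lt_imp_mem hγ).exists
  have h_tendsto : Tendsto (fun n => columns (Function.update γ k (2 ^ n - 1)) none ∆ x) atTop
      (𝓝 (columns γ (some k) ∆ x)) := by
    simp only [symmDiff_comm _ x]
    exact ((flipHomeomorph x).continuous.tendsto _).comp (tendsto_columns_update γ k)
  refine ⟨k, isClosed_closure.mem_of_tendsto h_tendsto (.of_forall fun n => ?_)⟩
  have h_mem := hk (Function.update γ k (2 ^ n - 1)) fun i hi => Function.update_of_ne hi.ne _ _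
  exact map_mem_closure (f := fun γ' : ℕ → ℕ => columns γ' none ∆ x)
    (continuous_columns_none_symmDiff x) h_mem fun _ => id

theorem not_borelReducible_eqvOmega_eqvE0_of_isClosed {Y : Type*} [TopologicalSpace Y]
    [SecondCountableTopology Y] {F : Setoid Y} {K : ℕ → Set (Y × Y)} (hK : ∀ m, IsClosed (K m))
    (hF : ∀ a b, F a b ↔ ∃ m, (a, b) ∈ K m) : ¬ BorelReducible (eqvOmega eqvE0) F := by
  rintro ⟨f, f_meas, hf⟩
  obtain ⟨C, hCG, hCd, hfC⟩ : ∃ C, IsGδ C ∧ Dense C ∧ ContinuousOn f C := by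
    borelize (ℕ → ℕ → Bool) Y
    exact exists_isGδ_dense_continuousOn f_meas
  obtain ⟨x, hx⟩ := exists_forall_apply_mem_of_dense_isGδ
    (fun p : (ℕ →₀ ℕ) × Option ℕ => flipHomeomorph (columns p.1 p.2)) hCG hCd
  obtain ⟨m, γ, hγ⟩ := exists_nhds_subset_closure_of_cover hCG (fun γ o => hx (γ, o))
    (K := fun m => {z | (f x, f z) ∈ K m})
    fun γ _ => (hF _ _).1 ((hf _ _).1 (eqvOmega_eqvE0_columns_none γ x))
  obtain ⟨k, hk⟩ := exists_columns_some_mem_closure hγ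
  set z := columns γ (some k) ∆ x
  have : NeBot (𝓝[C ∩ {z | (f x, f z) ∈ K m}] z) := mem_closure_iff_nhdsWithin_neBot.1 hk
  have h_tendsto : Tendsto f (𝓝[C ∩ {z | (f x, f z) ∈ K m}] z) (𝓝 (f z)) :=
    (hfC z (hx (γ, some k))).mono_left (nhdsWithin_mono _ Set.inter_subset_left)
  have h_mem : (f x, f z) ∈ K m := (hK m).mem_of_tendsto (tendsto_const_nhds.prodMk_nhds h_tendsto)
    (eventually_mem_nhdsWithin.mono fun z hz => hz.2)
  exact not_eqvOmega_eqvE0_columns_some γ k x ((hf _ _).2 ((hF _ _).2 ⟨m, h_mem⟩))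

end ClosedCover

theorem discreteTopology_of_countable_of_baireSpace {G : Type*} [Group G] [TopologicalSpace G]
    [SeparatelyContinuousMul G] [T1Space G] [BaireSpace G] [Countable G] : DiscreteTopology G := by
  obtain ⟨g, h, hh⟩ := nonempty_interior_of_iUnion_of_closed (f := fun g : G => ({g} : Set G))
    (fun _ => isClosed_singleton) (Set.iUnion_of_singleton G)
  obtain rfl : h = g := Set.mem_singleton_iff.1 (interior_subset hh)
  have h_open : IsOpen {h} := isOpen_iff_mem_nhds.2 <| by
    rintro _ rfl
    exact mem_interior_iff_mem_nhds.1 hh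
  refine discreteTopology_of_isOpen_singleton_one ?_
  simpa using h_open.preimage (continuous_const_mul h)

theorem not_borelReducible_eqvOmega_eqvE0_eqvGroup_of_countable {G : Type*} [Group G]
    [TopologicalSpace G] [IsTopologicalGroup G] [T2Space G] [BaireSpace G] [Countable G] :
    ¬ BorelReducible (eqvOmega eqvE0) (eqvGroup G) := by
  have : DiscreteTopology G := discreteTopology_of_countable_of_baireSpace
  let K (m : ℕ) : Set ((ℕ → G) × (ℕ → G)) :=
    ⋂ n ≥ m, {p | p.1 n * (p.2 n)⁻¹ = p.1 m * (p.2 m)⁻¹}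
  have K_closed (m) : IsClosed (K m) :=
    isClosed_biInter fun n _ => isClosed_eq (by fun_prop) (by fun_prop)
  refine not_borelReducible_eqvOmega_eqvE0_of_isClosed K_closed fun a b => ?_
  have h_const : eqvGroup G a b ↔ EventuallyConst (fun n => a n * (b n)⁻¹) atTop := by
    simp only [eventuallyConst_iff_tendsto, ← nhds_discrete]
    exact Iff.rfl
  rw [h_const, eventuallyConst_atTop]
  simp only [K, Set.mem_iInter, ge_iff_le]
  exact Iff.rfl

section Fusion

variable {X : Type*} [TopologicalSpace X] [TopologicalSpace.IsCompletelyMetrizableSpace X]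
  {S : ℕ → Type*} {z : ∀ k, S k → X} {R : ∀ k, S k → S (k + 1) → Prop} {W : ∀ k, S k → Set X}

theorem exists_tendsto_of_forall_exists_mem_nhds (hW : ∀ k s, W k s ∈ 𝓝 (z k s))
    (h_step : ∀ k s, ∀ U ∈ 𝓝 (z k s), ∃ s', R k s s' ∧ z (k + 1) s' ∈ U) (s₀ : S 0) :
    ∃ (s : ∀ k, S k) (y : X), (∀ k, R k (s k) (s (k + 1))) ∧
      Tendsto (fun k => z k (s k)) atTop (𝓝 y) ∧ ∀ k, y ∈ W k (s k) := by
  let _ := TopologicalSpace.upgradeIsCompletelyMetrizable X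
  -- Recursion on states equipped with a radius, keeping the balls nested.
  let B (k : ℕ) : Type _ := {p : S k × ℝ // 0 < p.2 ∧ Metric.closedBall (z k p.1) p.2 ⊆ W k p.1}
  have h_radius (k) (s : S k) (r : ℝ) (hr : 0 < r) : ∃ p : B k, p.1.1 = s ∧ p.1.2 ≤ r := by
    obtain ⟨r', hr', h_sub⟩ := Metric.nhds_basis_closedBall.mem_iff.1 (hW k s)
    exact ⟨⟨(s, min r r'), lt_min hr hr',
      (Metric.closedBall_subset_closedBall (min_le_right r r')).trans h_sub⟩, rfl, min_le_left r r'⟩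
  have h_next (k) (p : B k) : ∃ q : B (k + 1), R k p.1.1 q.1.1 ∧ q.1.2 ≤ (1 / 2) ^ (k + 1) ∧
      Metric.closedBall (z (k + 1) q.1.1) q.1.2 ⊆ Metric.closedBall (z k p.1.1) p.1.2 := by
    obtain ⟨s', hR, hs'⟩ := h_step k p.1.1 _ (Metric.ball_mem_nhds _ p.2.1)
    obtain ⟨r, hr, h_sub⟩ := Metric.nhds_basis_closedBall.mem_iff.1
      (Metric.isOpen_ball.mem_nhds hs')
    obtain ⟨q, rfl, hq⟩ := h_radius (k + 1) s' (min r ((1 / 2) ^ (k + 1))) (by positivity)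
    exact ⟨q, hR, hq.trans (min_le_right _ _), (Metric.closedBall_subset_closedBall
      (hq.trans (min_le_left _ _))).trans (h_sub.trans Metric.ball_subset_closedBall)⟩
  choose next hR h_small h_nested using h_next
  obtain ⟨p₀, rfl, hp₀⟩ := h_radius 0 s₀ 1 one_pos
  let p (k : ℕ) : B k := Nat.rec p₀ next k
  let ball (k : ℕ) : Set X := Metric.closedBall (z k (p k).1.1) (p k).1.2
  have h_anti : Antitone ball := antitone_nat_of_succ_le fun k => h_nested k (p k)
  have h_center (k) : z k (p k).1.1 ∈ ball k := Metric.mem_closedBall_self (p k).2.1.le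
  have h_le (k) : (p k).1.2 ≤ (1 / 2) ^ k := by
    cases k with
    | zero => exact hp₀.trans_eq (pow_zero _).symm
    | succ k => exact h_small k (p k)
  obtain ⟨y, hy⟩ := cauchySeq_tendsto_of_complete <| cauchySeq_of_le_geometric (1 / 2) 1
    (by norm_num) (f := fun k => z k (p k).1.1) fun k => by
      rw [dist_comm, one_mul]
      exact (Metric.mem_closedBall.1 (h_anti k.le_succ (h_center (k + 1)))).trans (h_le k)
  refine ⟨fun k => (p k).1.1, y, fun k => hR k (p k), hy, fun k => (p k).2.2 ?_⟩
  exact Metric.isClosed_closedBall.mem_of_tendsto hy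
    ((eventually_ge_atTop k).mono fun n hn => h_anti hn (h_center n))

theorem exists_tendsto_of_forall_exists_mem_nhds_of_isGδ {C : Set X} (hC : IsGδ C)
    (hzC : ∀ k s, z k s ∈ C) (hW : ∀ k s, W k s ∈ 𝓝[C] (z k s))
    (h_step : ∀ k s, ∀ U ∈ 𝓝 (z k s), ∃ s', R k s s' ∧ z (k + 1) s' ∈ U) (s₀ : S 0) :
    ∃ (s : ∀ k, S k) (y : X), (∀ k, R k (s k) (s (k + 1))) ∧ y ∈ C ∧
      Tendsto (fun k => z k (s k)) atTop (𝓝 y) ∧ ∀ k, y ∈ W k (s k) := by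
  obtain ⟨O, hO, rfl⟩ := isGδ_iff_eq_iInter_nat.1 hC
  choose V hV hVW using fun k s => mem_nhdsWithin_iff_exists_mem_nhds_inter.1 (hW k s)
  obtain ⟨s, y, hR, hy, hyV⟩ := exists_tendsto_of_forall_exists_mem_nhds
    (W := fun k s => V k s ∩ O k)
    (fun k s => inter_mem (hV k s) ((hO k).mem_nhds (Set.mem_iInter.1 (hzC k s) k))) h_step s₀
  have hyC : y ∈ ⋂ k, O k := Set.mem_iInter.2 fun k => (hyV k).2
  exact ⟨s, y, hR, hyC, hy, fun k => hVW k (s k) ⟨(hyV k).1, hyC⟩⟩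

end Fusion

theorem normalClosure_toSubmonoid_le {Λ : Type*} [Group Λ] {M : Submonoid Λ} {D : Set Λ}
    (h_inv : ∀ d ∈ D, d⁻¹ ∈ D) (h_conj : ∀ d ∈ D, ∀ a, a * d * a⁻¹ ∈ M) :
    (Subgroup.normalClosure D).toSubmonoid ≤ M := by
  rw [Subgroup.normalClosure, Subgroup.closure_toSubmonoid, Submonoid.closure_le]
  rintro c (hc | hc) <;>
    obtain ⟨d, hd, a, h_eq⟩ := by
      simpa only [Set.mem_inv, Group.mem_conjugatesOfSet_iff, isConj_iff] using hc
  · exact h_eq ▸ h_conj d hd a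
  · have h_eq' : a * d⁻¹ * a⁻¹ = c := by rw [← inv_inj, ← h_eq]; group
    exact h_eq' ▸ h_conj d⁻¹ (h_inv d hd) a

theorem countable_setOf_eventuallyConst_atTop {Λ : Type*} [Countable Λ] :
    {β : ℕ → Λ | EventuallyConst β atTop}.Countable := by
  refine (Set.countable_range fun p : List Λ × Λ => fun i => p.1.getD i p.2).mono fun β hβ => ?_
  obtain ⟨m, hm⟩ := eventuallyConst_atTop.1 hβ
  refine ⟨(List.ofFn fun i : Fin m => β i, β m), funext fun i => ?_⟩
  obtain hi | hi := lt_or_ge i m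
  · simp [List.getD, hi]
  · simp [List.getD, hi, hm i hi]

theorem eventuallyConst_ite_lt {Λ : Type*} {γ δ : ℕ → Λ} (hδ : EventuallyConst δ atTop) (M : ℕ) :
    EventuallyConst (fun i => if i < M then γ i else δ i) atTop :=
  hδ.congr ((eventually_ge_atTop M).mono fun _ hi => (if_neg hi.not_gt).symm)

section StepSeq

variable {Λ : Type*} [Group Λ]

/-- The sequence jumping from `1` to `u` at index `N`. -/
noncomputable def stepSeq (N : ℕ) (u : Λ) : ℕ → Λ := (Set.Ici N).mulIndicator fun _ => u

theorem stepSeq_of_lt {N i : ℕ} (u : Λ) (hi : i < N) : stepSeq N u i = 1 :=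
  Set.mulIndicator_of_notMem (Set.notMem_Ici.2 hi) _

theorem stepSeq_of_le {N i : ℕ} (u : Λ) (hi : N ≤ i) : stepSeq N u i = u :=
  Set.mulIndicator_of_mem hi _

theorem eventually_stepSeq_eq (N : ℕ) (u : Λ) : ∀ᶠ i in atTop, stepSeq N u i = u :=
  (eventually_ge_atTop N).mono fun _ => stepSeq_of_le u

theorem eventuallyConst_stepSeq (N : ℕ) (u : Λ) : EventuallyConst (stepSeq N u) atTop :=
  .of_tendsto (tendsto_pure.2 (eventually_stepSeq_eq N u))

theorem mul_stepSeq_conj_eq {α : ℕ → Λ} {M : ℕ} {a : Λ} (hα : ∀ i ≥ M, α i = a⁻¹)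
    {N : ℕ} (hN : M ≤ N) (u : Λ) : α * stepSeq N (a * u * a⁻¹) = stepSeq N u * α := by
  ext i
  obtain hi | hi := lt_or_ge i N
  · simp [stepSeq_of_lt _ hi]
  · simp [stepSeq_of_le _ hi, hα i (hN.trans hi), mul_assoc]

/-- The sequences jumping from `1` to an element of `S`, not before index `N₀`. -/
def lateJumps (S : Set Λ) (N₀ : ℕ) : Set (ℕ → Λ) := {β | ∃ N ≥ N₀, ∃ u ∈ S, stepSeq N u = β}

theorem eventuallyConst_of_mem_lateJumps {S : Set Λ} {N₀ : ℕ} {β : ℕ → Λ}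
    (hβ : β ∈ lateJumps S N₀) : EventuallyConst β atTop := by
  obtain ⟨N, -, u, -, rfl⟩ := hβ
  exact eventuallyConst_stepSeq N u

end StepSeq

section GenericPoint

variable {Λ : Type*} [Group Λ]

/-- Left translation of `z` by the elements of `B` changes the values of `θ` by at most `ε` from
index `J` on. -/
def MovesWithin (θ : (ℕ → Λ) → ℕ → ℝ) (B : Set (ℕ → Λ)) (ε : ℚ≥0) (J : ℕ) (z : ℕ → Λ) : Prop :=
  ∀ β ∈ B, ∀ j ≥ J, |θ (β * z) j - θ z j| ≤ ε

/-- A point `x` whose orbit under eventually constant translations stays in a Gδ set `C` where `θ`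
is continuous and where the relevant bounds `MovesWithin` are relatively open conditions. -/
structure IsGenericFor [TopologicalSpace Λ] (θ : (ℕ → Λ) → ℕ → ℝ) (S : ℕ → Set Λ)
    (C : Set (ℕ → Λ)) (x : ℕ → Λ) : Prop where
  isGδ : IsGδ C
  mul_mem : ∀ β, EventuallyConst β atTop → β * x ∈ C
  continuousOn : ContinuousOn θ C
  eventually_movesWithin_singleton : ∀ β, EventuallyConst β atTop → ∀ ε J, ∀ z ∈ C,
    MovesWithin θ {β} ε J z → ∀ᶠ w in 𝓝[C] z, MovesWithin θ {β} ε J w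
  eventually_movesWithin_lateJumps : ∀ n N₀ ε J, ∀ z ∈ C,
    MovesWithin θ (lateJumps (S n) N₀) ε J z →
      ∀ᶠ w in 𝓝[C] z, MovesWithin θ (lateJumps (S n) N₀) ε J w

variable [TopologicalSpace Λ] [DiscreteTopology Λ]

theorem measurableSet_setOf_movesWithin [MeasurableSpace (ℕ → Λ)] [BorelSpace (ℕ → Λ)]
    {θ : (ℕ → Λ) → ℕ → ℝ} (hθ : Measurable θ) {B : Set (ℕ → Λ)} (hB : B.Countable) (ε : ℚ≥0)
    (J : ℕ) : MeasurableSet {z | MovesWithin θ B ε J z} := by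
  simp only [MovesWithin, Set.ofPred_forall]
  refine .biInter hB fun β _ => .iInter fun j => .iInter fun _ => ?_
  have hθβ : Measurable fun z => θ (β * z) := hθ.comp (continuous_const_mul β).measurable
  exact measurableSet_le
    ((measurable_pi_apply j).comp hθβ |>.sub ((measurable_pi_apply j).comp hθ) |>.abs)
    measurable_const

theorem exists_isGenericFor [Countable Λ] {θ : (ℕ → Λ) → ℕ → ℝ}
    (hθ : @Measurable _ _ (borel (ℕ → Λ)) (borel (ℕ → ℝ)) θ) (S : ℕ → Set Λ) :
    ∃ C x, IsGenericFor θ S C x := by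
  borelize (ℕ → Λ)
  rw [← BorelSpace.measurable_eq (α := ℕ → ℝ)] at hθ
  let Γ := {β : ℕ → Λ // EventuallyConst β atTop}
  have : Countable Γ := countable_setOf_eventuallyConst_atTop.to_subtype
  have h_countable (n N₀) : (lateJumps (S n) N₀).Countable :=
    countable_setOf_eventuallyConst_atTop.mono fun β => eventuallyConst_of_mem_lateJumps
  obtain ⟨C₁, hG₁, hd₁, hC₁⟩ := exists_isGδ_dense_continuousOn hθ
  obtain ⟨C₂, hG₂, hd₂, hC₂⟩ := exists_isGδ_dense_forall_mem_nhdsWithin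
    fun p : Γ × ℚ≥0 × ℕ => measurableSet_setOf_movesWithin hθ (Set.countable_singleton p.1.1)
      p.2.1 p.2.2
  obtain ⟨C₃, hG₃, hd₃, hC₃⟩ := exists_isGδ_dense_forall_mem_nhdsWithin
    fun p : ℕ × ℕ × ℚ≥0 × ℕ => measurableSet_setOf_movesWithin hθ (h_countable p.1 p.2.1)
      p.2.2.1 p.2.2.2
  have hG := (hG₁.inter hG₂).inter hG₃
  obtain ⟨x, hx⟩ := exists_forall_apply_mem_of_dense_isGδ (fun β : Γ => Homeomorph.mulLeft β.1)
    hG ((hd₁.inter_of_Gδ hG₁ hG₂ hd₂).inter_of_Gδ (hG₁.inter hG₂) hG₃ hd₃)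
  exact ⟨_, x, {
    isGδ := hG
    mul_mem := fun β hβ => hx ⟨β, hβ⟩
    continuousOn := hC₁.mono fun z hz => hz.1.1
    eventually_movesWithin_singleton := fun β hβ ε J z hz h =>
      nhdsWithin_mono z (fun w hw => hw.1.2) (hC₂ (⟨β, hβ⟩, ε, J) z hz.1.2 h)
    eventually_movesWithin_lateJumps := fun n N₀ ε J z hz h =>
      nhdsWithin_mono z (fun w hw => hw.2) (hC₃ (n, N₀, ε, J) z hz.2 h) }⟩

end GenericPoint

section ReducesVia

variable {G : Type*} [Group G] [TopologicalSpace G] {Λ : Type*} [Group Λ] {φ : Λ →* G}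
  {θ : (ℕ → Λ) → ℕ → ℝ}

theorem tendsto_mul_inv_nhds_one_of_forall_eq_or_mem [TopologicalSpace Λ] [DiscreteTopology Λ]
    {T : ℕ → Set G} (hT : (𝓝 (1 : G)).HasAntitoneBasis T) {β : ℕ → ℕ → Λ} {x y : ℕ → Λ}
    (hβ : ∀ k, ∀ᶠ i in atTop, β k i = 1)
    (hβT : ∀ k i, β (k + 1) i = β k i ∨ β (k + 1) i ∈ φ ⁻¹' T (k + 1))
    (hy : Tendsto (fun k => β k * x) atTop (𝓝 y)) :
    Tendsto (fun i => (φ ∘ y) i * ((φ ∘ x) i)⁻¹) atTop (𝓝 1) := by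
  refine hT.toHasBasis.tendsto_right_iff.2 fun m _ => (hβ m).mono fun i hi => ?_
  have h_mem : ∀ k ≥ m, φ (β k i) ∈ T m := Nat.le_induction
    (by simpa [hi] using mem_of_mem_nhds (hT.mem m)) fun k hk h_ind =>
      (hβT k i).elim (fun h_eq => h_eq ▸ h_ind) fun h_mem => hT.antitone (by lia) h_mem
  obtain ⟨k, hk, h_eq⟩ : ∃ k ≥ m, β k i * x i = y i :=
    ((eventually_ge_atTop m).and
      (tendsto_pure.1 (nhds_discrete Λ ▸ tendsto_pi_nhds.1 hy i))).exists
  simpa [← h_eq] using h_mem k hk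

variable [IsTopologicalGroup G]

/-- `θ` reduces the pullback of `E(G)` along `φ` to `ℝ^ω / c₀`. -/
def ReducesVia (φ : Λ →* G) (θ : (ℕ → Λ) → ℕ → ℝ) : Prop :=
  ∀ x y, eqvGroup G (φ ∘ x) (φ ∘ y) ↔ eqvRc0 (θ x) (θ y)

theorem ReducesVia.eqvRc0_mul (h : ReducesVia φ θ) {β : ℕ → Λ} (hβ : EventuallyConst β atTop)
    (z : ℕ → Λ) : eqvRc0 (θ (β * z)) (θ z) := by
  obtain ⟨b, hb⟩ := eventuallyConst_iff_exists_eventuallyEq.1 hβ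
  exact (h _ _).1 ⟨φ b, tendsto_const_nhds.congr' (hb.mono fun i hi => by simp [hi])⟩

theorem eventually_abs_sub_le_of_eqvRc0 {a b : ℕ → ℝ} (hab : eqvRc0 a b) {ε : ℝ} (hε : 0 < ε) :
    ∀ᶠ j in atTop, |a j - b j| ≤ ε := by
  have h_lim : Tendsto (fun j => a j - b j) atTop (𝓝 0) := hab
  simpa using h_lim.eventually (Metric.closedBall_mem_nhds 0 hε)

variable [TopologicalSpace Λ] {S : ℕ → Set Λ} {C : Set (ℕ → Λ)} {x : ℕ → Λ}

theorem IsGenericFor.eventually_forall_mul_mem (hx : IsGenericFor θ S C x)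
    {γ : ℕ → Λ} {V : Set (ℕ → Λ)} (hV : V ∈ 𝓝[C] (γ * x)) :
    ∀ᶠ M in atTop, ∀ β, EventuallyConst β atTop → (∀ i < M, β i = γ i) → β * x ∈ V := by
  obtain ⟨U, hU, hUV⟩ := mem_nhdsWithin_iff_exists_mem_nhds_inter.1 hV
  filter_upwards [eventually_forall_eq_of_lt_imp_mem hU] with M hM β hβ hβγ
  exact hUV ⟨hM _ fun i hi => congrArg (· * x i) (hβγ i hi), hx.mul_mem β hβ⟩

theorem IsGenericFor.eventually_stepSeq_mul_mem (hx : IsGenericFor θ S C x)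
    {β : ℕ → Λ} (hβ : EventuallyConst β atTop) {V : Set (ℕ → Λ)} (hV : V ∈ 𝓝[C] (β * x)) :
    ∀ᶠ N in atTop, ∀ u, stepSeq N u * β * x ∈ V :=
  (hx.eventually_forall_mul_mem hV).mono fun N hN u =>
    hN _ ((eventuallyConst_stepSeq N u).mul hβ) fun i hi => by
      rw [Pi.mul_apply, stepSeq_of_lt u hi, one_mul]

theorem IsGenericFor.tendsto_apply (hx : IsGenericFor θ S C x) {z : ℕ → Λ} (hz : z ∈ C) (j : ℕ) :
    Tendsto (fun w => θ w j) (𝓝[C] z) (𝓝 (θ z j)) :=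
  tendsto_pi_nhds.1 (hx.continuousOn z hz) j

theorem ReducesVia.exists_stepSeq_far (h : ReducesVia φ θ) (hx : IsGenericFor θ S C x) {ε : ℚ≥0}
    (hε : 0 < ε) {k : ℕ} {β : ℕ → Λ} (hβ : ∀ᶠ i in atTop, β i = 1)
    (h_not : ∀ J N₀, ¬ MovesWithin θ (lateJumps (S k) N₀) ε J (β * x))
    {U : Set (ℕ → Λ)} (hU : U ∈ 𝓝 (β * x)) :
    ∃ N, ∃ u ∈ S k, (∀ i ≥ N, β i = 1) ∧ U ∈ 𝓝 (stepSeq N u * β * x) ∧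
      ∃ j ≥ k, ε / 2 < |θ (stepSeq N u * β * x) j - θ x j| := by
  have hβ_const : EventuallyConst β atTop := .of_tendsto (tendsto_pure.2 hβ)
  have hε' : (0 : ℝ) < ε / 2 := by positivity
  obtain ⟨J, hJk, hJ⟩ : ∃ J ≥ k, ∀ j ≥ J, |θ (β * x) j - θ x j| ≤ ε / 2 :=
    ((eventually_ge_atTop k).and
      (eventually_forall_ge_atTop.2 <|
        eventually_abs_sub_le_of_eqvRc0 (h.eqvRc0_mul hβ_const x) hε')).exists
  obtain ⟨N₀, hN₀⟩ := eventually_atTop.1 <| (eventually_forall_ge_atTop.2 hβ).and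
    (hx.eventually_stepSeq_mul_mem hβ_const
      (mem_nhdsWithin_of_mem_nhds (eventually_mem_nhds_iff.2 hU)))
  obtain ⟨_, ⟨N, hN, u, hu, rfl⟩, j, hj, h_jump⟩ : ∃ γ ∈ lateJumps (S k) N₀, ∃ j ≥ J,
      ε < |θ (γ * (β * x)) j - θ (β * x) j| := by
    simpa only [MovesWithin, not_forall, not_le, exists_prop] using h_not J N₀
  rw [← mul_assoc] at h_jump
  refine ⟨N, u, hu, (hN₀ N hN).1, (hN₀ N hN).2 u, j, hJk.trans hj, ?_⟩
  linarith [hJ j hj, abs_sub_le (θ (stepSeq N u * β * x) j) (θ x j) (θ (β * x) j),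
    abs_sub_comm (θ x j) (θ (β * x) j)]

theorem ReducesVia.exists_eventually_eq_one_far (h : ReducesVia φ θ) (hx : IsGenericFor θ S C x)
    {ε : ℚ≥0} (hε : 0 < ε) {k : ℕ} (h_one : 1 ∈ S k) {β : ℕ → Λ} (hβ : ∀ᶠ i in atTop, β i = 1)
    (h_not : ∀ J N₀, ¬ MovesWithin θ (lateJumps (S k) N₀) ε J (β * x))
    {U : Set (ℕ → Λ)} (hU : U ∈ 𝓝 (β * x)) :
    ∃ β' : ℕ → Λ, (∀ᶠ i in atTop, β' i = 1) ∧ (∃ j ≥ k, ε / 2 < |θ (β' * x) j - θ x j|) ∧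
      (∀ i, β' i = β i ∨ β' i ∈ S k) ∧ β' * x ∈ U := by
  obtain ⟨N, u, hu, hβN, hUγ, j, hj, h_far⟩ := h.exists_stepSeq_far hx hε hβ h_not hU
  have hβ_const : EventuallyConst β atTop := .of_tendsto (tendsto_pure.2 hβ)
  set γ := stepSeq N u * β with hγ
  have h_near : ∀ᶠ w in 𝓝[C] (γ * x), w ∈ U ∧ ε / 2 < |θ w j - θ x j| :=
    Eventually.and (mem_nhdsWithin_of_mem_nhds hUγ)
      (((hx.tendsto_apply (hx.mul_mem γ ((eventuallyConst_stepSeq N u).mul hβ_const)) j).sub_const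
        _).abs.eventually_const_lt h_far)
  obtain ⟨M, hM⟩ := (hx.eventually_forall_mul_mem h_near).exists
  obtain ⟨hβ'U, hβ'⟩ := hM (fun i => if i < M then γ i else 1)
    (eventuallyConst_ite_lt (.const _) M) fun i hi => if_pos hi
  refine ⟨_, (eventually_ge_atTop M).mono fun i hi => if_neg hi.not_gt, ⟨j, hj, hβ'⟩,
    fun i => ?_, hβ'U⟩
  split_ifs
  · obtain hi | hi := lt_or_ge i N
    · simp [hγ, stepSeq_of_lt u hi]
    · exact .inr (by simpa [hγ, stepSeq_of_le u hi, hβN i hi] using hu)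
  · exact .inr h_one

variable [DiscreteTopology Λ] {T : ℕ → Set G}

/-- Otherwise far jumps can be accumulated into a single `β` that tends to `1` along `φ` although
`θ (β * x) - θ x` does not tend to `0`. -/
theorem ReducesVia.exists_movesWithin_lateJumps (h : ReducesVia φ θ)
    (hT : (𝓝 (1 : G)).HasAntitoneBasis T) (hx : IsGenericFor θ (fun n => φ ⁻¹' T n) C x) {ε : ℚ≥0}
    (hε : 0 < ε) : ∃ n, ∃ β : ℕ → Λ, EventuallyConst β atTop ∧
      ∃ J N₀, MovesWithin θ (lateJumps (φ ⁻¹' T n) N₀) ε J (β * x) := by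
  by_contra! h_not
  have h_const {β : ℕ → Λ} (hβ : ∀ᶠ i in atTop, β i = 1) : EventuallyConst β atTop :=
    .of_tendsto (tendsto_pure.2 hβ)
  have h_one (k) : (1 : Λ) ∈ φ ⁻¹' T k := by simpa using mem_of_mem_nhds (hT.mem k)
  let Far (k : ℕ) (w : ℕ → Λ) : Prop := ∃ j ≥ k, ε / 2 < |θ w j - θ x j|
  have h_step (k) (β : ℕ → Λ) (hβ : ∀ᶠ i in atTop, β i = 1) {U} (hU : U ∈ 𝓝 (β * x)) :=
    h.exists_eventually_eq_one_far hx hε (h_one k) hβ (h_not k β (h_const hβ)) hU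
  obtain ⟨β₀, hβ₀, h_far₀, -⟩ := h_step 0 1 (.of_forall fun _ => rfl) univ_mem
  have h_open (k : ℕ) (z) (hz : z ∈ C) (hzk : Far k z) : {w | Far k w} ∈ 𝓝[C] z := by
    obtain ⟨j, hj, h_lt⟩ := hzk
    exact (((hx.tendsto_apply hz j).sub_const _).abs.eventually_const_lt h_lt).mono
      fun w hw => ⟨j, hj, hw⟩
  obtain ⟨β, y, hR, -, h_lim, hy⟩ := exists_tendsto_of_forall_exists_mem_nhds_of_isGδ
    (S := fun k => {β : ℕ → Λ // (∀ᶠ i in atTop, β i = 1) ∧ Far k (β * x)})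
    (z := fun _ β => β.1 * x) (W := fun k _ => {w | Far k w})
    (R := fun k β β' => ∀ i, β'.1 i = β.1 i ∨ β'.1 i ∈ φ ⁻¹' T (k + 1)) hx.isGδ
    (fun k β => hx.mul_mem _ (h_const β.2.1))
    (fun k β => h_open k _ (hx.mul_mem _ (h_const β.2.1)) β.2.2)
    (fun k β U hU => by
      obtain ⟨β', hβ', ⟨j, hj, h_far⟩, hR, hβ'U⟩ := h_step (k + 1) β.1 β.2.1 hU
      exact ⟨⟨β', hβ', ⟨j, hj, h_far⟩⟩, hR, hβ'U⟩) ⟨β₀, hβ₀, h_far₀⟩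
  have h_eqv : eqvGroup G (φ ∘ y) (φ ∘ x) :=
    ⟨1, tendsto_mul_inv_nhds_one_of_forall_eq_or_mem hT (fun k => (β k).2.1) hR h_lim⟩
  have h_zero : Tendsto (fun j => θ y j - θ x j) atTop (𝓝 0) := (h _ _).1 h_eqv
  obtain ⟨k, hk⟩ := eventually_atTop.1 <|
    h_zero.abs.eventually_lt_const (u := (ε : ℝ) / 2) (by simpa using hε)
  obtain ⟨j, hj, h_far⟩ := hy k
  exact (hk j hj).not_gt h_far

end ReducesVia

section SlowMoves

variable {G : Type*} [Group G] [TopologicalSpace G] [IsTopologicalGroup G]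
  {Λ : Type*} [Group Λ] [TopologicalSpace Λ] {φ : Λ →* G} {θ : (ℕ → Λ) → ℕ → ℝ}
  {S : ℕ → Set Λ} {C : Set (ℕ → Λ)} {x : ℕ → Λ}

/-- A bound on late jumps near `β₀ * x` passes to conjugate jumps near any `β * x`: a sequence that
agrees with `β₀` up to a late index and with `a⁻¹ * β` from there on intertwines the jumps. -/
theorem ReducesVia.exists_movesWithin_lateJumps_conj (h : ReducesVia φ θ)
    (hx : IsGenericFor θ S C x) {ε : ℚ≥0} (hε : 0 < ε) {n J₀ N₀ : ℕ} {β₀ β : ℕ → Λ}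
    (hβ₀ : EventuallyConst β₀ atTop) (hβ : EventuallyConst β atTop)
    (h_move : MovesWithin θ (lateJumps (S n) N₀) (ε / 3) J₀ (β₀ * x)) (a : Λ) :
    ∃ J N₁, MovesWithin θ (lateJumps (MulAut.conj a '' S n) N₁) ε J (β * x) := by
  obtain ⟨M, hMN₀, hM⟩ := ((eventually_ge_atTop N₀).and <| hx.eventually_forall_mul_mem <|
    hx.eventually_movesWithin_lateJumps n N₀ _ J₀ _ (hx.mul_mem β₀ hβ₀) h_move).exists
  let γ (i : ℕ) : Λ := if i < M then β₀ i else a⁻¹ * β i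
  have hγ : EventuallyConst γ atTop := eventuallyConst_ite_lt ((EventuallyConst.const a⁻¹).mul hβ) M
  have h_near : MovesWithin θ (lateJumps (S n) N₀) (ε / 3) J₀ (γ * x) :=
    hM γ hγ fun i hi => if_pos hi
  let α : ℕ → Λ := γ * β⁻¹
  have hα_const : EventuallyConst α atTop := hγ.mul hβ.inv
  have hα (i) (hi : i ≥ M) : α i = a⁻¹ := by simp [α, γ, hi.not_gt]
  have hαγ : γ * x = α * (β * x) := by simp [α, mul_assoc]
  obtain ⟨J₁, h_before⟩ : ∃ J₁, MovesWithin θ {α} (ε / 3) J₁ (β * x) := by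
    have h_eqv := h.eqvRc0_mul hα_const (β * x)
    simpa [MovesWithin] using eventually_atTop.1 <|
      eventually_abs_sub_le_of_eqvRc0 h_eqv (ε := ε / 3) (by positivity)
  obtain ⟨N₁, hN₁⟩ := eventually_atTop.1 <| hx.eventually_stepSeq_mul_mem hβ <|
    hx.eventually_movesWithin_singleton α hα_const _ J₁ _ (hx.mul_mem β hβ) h_before
  refine ⟨max J₀ J₁, max M N₁, ?_⟩
  rintro _ ⟨N, hN, _, ⟨u, hu, rfl⟩, rfl⟩ j hj
  have hMN : M ≤ N := (le_max_left _ _).trans hN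
  set w := stepSeq N (MulAut.conj a u) * (β * x) with hw
  have hαw : stepSeq N u * (γ * x) = α * w := by
    rw [hαγ, hw, MulAut.conj_apply, ← mul_assoc, ← mul_assoc α, mul_stepSeq_conj_eq hα hMN]
  have h_near' := h_near _ ⟨N, hMN₀.trans hMN, u, hu, rfl⟩ j ((le_max_left _ _).trans hj)
  have h_before' := h_before α rfl j ((le_max_right _ _).trans hj)
  have h_after := hN₁ N ((le_max_right _ _).trans hN) (MulAut.conj a u) α rfl j
    ((le_max_right _ _).trans hj)
  rw [hαw, hαγ] at h_near'
  rw [mul_assoc (stepSeq _ _)] at h_after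
  push_cast at h_near' h_before' h_after
  rw [abs_le] at *
  constructor <;> linarith

/-- The elements `d` such that every `β * x`, with `β` eventually constant, can be changed slowly
into a `β' * x` with `β'` eventually equal to `d * β`: the new point is arbitrarily near the old
one, `θ` changes by barely more than `ε` at every index, and arbitrarily little at the first
ones. -/
def slowMoves (hθ : ∀ β, EventuallyConst β atTop → eqvRc0 (θ (β * x)) (θ x)) (ε : ℚ≥0) :
    Submonoid Λ where
  carrier := {d | ∀ δ > 0, ∀ J : ℕ, ∀ b : Λ, ∀ β : ℕ → Λ, (∀ᶠ i in atTop, β i = b) →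
    ∀ U ∈ 𝓝 (β * x), ∃ β' : ℕ → Λ, (∀ᶠ i in atTop, β' i = d * b) ∧ β' * x ∈ U ∧
      (∀ j, |θ (β' * x) j - θ (β * x) j| ≤ ε + δ) ∧ ∀ j < J, |θ (β' * x) j - θ (β * x) j| ≤ δ}
  one_mem' := fun δ hδ J b β hβ U hU =>
    ⟨β, by simpa using hβ, mem_of_mem_nhds hU, fun j => by
      simpa only [sub_self, abs_zero] using (by positivity : 0 ≤ (ε : ℝ) + δ), by simp [hδ.le]⟩
  mul_mem' := by
    intro d d' hd hd' δ hδ J b β hβ U hU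
    obtain ⟨β₁, hβ₁, hU₁, h_all₁, h_lt₁⟩ := hd' (δ / 2) (half_pos hδ) J b β hβ (interior U)
      (interior_mem_nhds.2 hU)
    have h_eqv : eqvRc0 (θ (β₁ * x)) (θ (β * x)) :=
      eqvRc0.trans (hθ β₁ (.of_tendsto (tendsto_pure.2 hβ₁)))
        (eqvRc0.symm (hθ β (.of_tendsto (tendsto_pure.2 hβ))))
    obtain ⟨J₁, hJ₁⟩ := eventually_atTop.1 (eventually_abs_sub_le_of_eqvRc0 h_eqv (half_pos hδ))
    obtain ⟨β₂, hβ₂, hU₂, h_all₂, h_lt₂⟩ := hd (δ / 2) (half_pos hδ) (max J J₁) (d' * b) β₁ hβ₁ U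
      (mem_interior_iff_mem_nhds.1 hU₁)
    refine ⟨β₂, by simpa only [mul_assoc] using hβ₂, hU₂, fun j => ?_, fun j hj => ?_⟩
    · have h_tri := abs_sub_le (θ (β₂ * x) j) (θ (β₁ * x) j) (θ (β * x) j)
      obtain hj | hj := lt_or_ge j J₁
      · linarith [h_lt₂ j (lt_max_of_lt_right hj), h_all₁ j]
      · linarith [h_all₂ j, hJ₁ j hj]
    · linarith [abs_sub_le (θ (β₂ * x) j) (θ (β₁ * x) j) (θ (β * x) j), h_lt₁ j hj,
        h_lt₂ j (lt_max_of_lt_left hj)]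

theorem IsGenericFor.mem_slowMoves (hx : IsGenericFor θ S C x)
    (hθ : ∀ β, EventuallyConst β atTop → eqvRc0 (θ (β * x)) (θ x)) {ε : ℚ≥0} {d : Λ}
    (hd : ∀ β, EventuallyConst β atTop → ∃ J N₀, MovesWithin θ (lateJumps {d} N₀) ε J (β * x)) :
    d ∈ slowMoves hθ ε := by
  intro δ hδ J b β hβ U hU
  have hβ_const : EventuallyConst β atTop := .of_tendsto (tendsto_pure.2 hβ)
  obtain ⟨J₁, N₀, h_move⟩ := hd β hβ_const
  have h_near : ∀ᶠ w in 𝓝[C] (β * x), w ∈ U ∧ ∀ j < max J J₁, |θ w j - θ (β * x) j| ≤ δ :=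
    Eventually.and (mem_nhdsWithin_of_mem_nhds hU) <|
      (eventually_all_finite (Set.finite_Iio _)).2 fun j _ =>
        (hx.tendsto_apply (hx.mul_mem β hβ_const) j).eventually (Metric.closedBall_mem_nhds _ hδ)
  obtain ⟨N, hN, hNU, h_lt⟩ : ∃ N ≥ N₀, stepSeq N d * β * x ∈ U ∧
      ∀ j < max J J₁, |θ (stepSeq N d * β * x) j - θ (β * x) j| ≤ δ :=
    ((eventually_ge_atTop N₀).and
      ((hx.eventually_stepSeq_mul_mem hβ_const h_near).mono fun N hN => hN d)).exists
  refine ⟨stepSeq N d * β, ?_, hNU, fun j => ?_, fun j hj => h_lt j (lt_max_of_lt_left hj)⟩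
  · filter_upwards [eventually_stepSeq_eq N d, hβ] with i hi hi'
    rw [Pi.mul_apply, hi, hi']
  · obtain hj | hj := lt_or_ge j J₁
    · linarith [h_lt j (lt_max_of_lt_right hj), (ε.cast_nonneg : (0 : ℝ) ≤ ε)]
    · rw [mul_assoc]
      linarith [h_move _ ⟨N, hN, d, rfl, rfl⟩ j hj]

theorem ReducesVia.exists_normalClosure_le_slowMoves [DiscreteTopology Λ]
    {T : ℕ → Set G} (h : ReducesVia φ θ) (hT : (𝓝 (1 : G)).HasAntitoneBasis T)
    (hx : IsGenericFor θ (fun n => φ ⁻¹' T n) C x) {ε : ℚ≥0} (hε : 0 < ε) : ∃ U ∈ 𝓝 (1 : G),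
      (Subgroup.normalClosure (φ ⁻¹' U)).toSubmonoid ≤
        slowMoves (fun _ hβ => h.eqvRc0_mul hβ x) ε := by
  obtain ⟨n, β₀, hβ₀, J₀, N₀, h_move⟩ :=
    h.exists_movesWithin_lateJumps hT hx (show 0 < ε / 3 by positivity)
  refine ⟨T n ∩ (T n)⁻¹, inter_mem (hT.mem n) (inv_mem_nhds_one G (hT.mem n)),
    normalClosure_toSubmonoid_le (fun d hd => by simpa [and_comm] using hd) fun d hd a =>
      hx.mem_slowMoves _ fun β hβ => ?_⟩
  obtain ⟨J, N₁, h_conj⟩ := h.exists_movesWithin_lateJumps_conj hx hε hβ₀ hβ h_move a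
  refine ⟨J, N₁, fun γ hγ => h_conj γ ?_⟩
  obtain ⟨N, hN, _, rfl, rfl⟩ := hγ
  exact ⟨N, hN, _, ⟨d, hd.1, rfl⟩, rfl⟩

end SlowMoves

/-- If, for each `k`, row `k` is small from some index on while row `k + 1` differs little from it
before that index, then no index sees more than one large change. -/
theorem tendsto_zero_of_forall_exists_abs_sub_le {F : ℕ → ℕ → ℝ} {f ε : ℕ → ℝ}
    (hF : ∀ j, Tendsto (fun k => F k j) atTop (𝓝 (f j))) (hε : Tendsto ε atTop (𝓝 0))
    (h_all : ∀ k j, |F (k + 1) j - F k j| ≤ ε k)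
    (h_split : ∀ k, ∃ J, (∀ j ≥ J, |F k j| ≤ (1 / 2) ^ k) ∧
      ∀ j < J, |F (k + 1) j - F k j| ≤ (1 / 2) ^ k) : Tendsto f atTop (𝓝 0) := by
  refine Metric.nhds_basis_closedBall.tendsto_right_iff.2 fun δ hδ => ?_
  have h_pow : Tendsto (fun k : ℕ => (1 / 2 : ℝ) ^ k) atTop (𝓝 0) :=
    tendsto_pow_atTop_nhds_zero_of_lt_one (by norm_num) (by norm_num)
  have h_small : ∀ᶠ k in atTop, (1 / 2 : ℝ) ^ k ≤ δ / 4 ∧ ε k ≤ δ / 4 :=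
    (h_pow.eventually_le_const (by positivity)).and (hε.eventually_le_const (by positivity))
  obtain ⟨K, hK⟩ := eventually_atTop.1 h_small
  obtain ⟨J, hJ, -⟩ := h_split K
  filter_upwards [eventually_ge_atTop J] with j hj
  have h_bound : ∀ k ≥ K, |F k j| ≤ δ - 2 * (1 / 2) ^ k := by
    refine Nat.le_induction ?_ fun k hk h_ind => ?_
    · linarith [hJ j hj, hK K le_rfl]
    · have h_tri := abs_add_le (F (k + 1) j - F k j) (F k j)
      rw [sub_add_cancel] at h_tri
      obtain ⟨J', h_ge, h_lt⟩ := h_split k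
      obtain hj' | hj' := lt_or_ge j J'
      · rw [pow_succ]
        linarith [h_lt j hj']
      · rw [pow_succ]
        linarith [h_ge j hj', h_all k j, hK k hk]
  rw [mem_closedBall_zero_iff, Real.norm_eq_abs]
  refine le_of_tendsto (hF j).abs ((eventually_ge_atTop K).mono fun k hk => ?_)
  linarith [h_bound k hk, pow_pos (one_half_pos (α := ℝ)) k]

section SlowMovesConvergence

variable {G : Type*} [Group G] [TopologicalSpace G] [IsTopologicalGroup G]
  {Λ : Type*} [Group Λ] [TopologicalSpace Λ] [DiscreteTopology Λ] {φ : Λ →* G}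
  {θ : (ℕ → Λ) → ℕ → ℝ} {S : ℕ → Set Λ} {C : Set (ℕ → Λ)} {x : ℕ → Λ}

theorem ReducesVia.exists_tendsto_slowMoves (h : ReducesVia φ θ) (hx : IsGenericFor θ S C x)
    {ε : ℕ → ℚ≥0} {c : ℕ → Λ}
    (hc : ∀ k, c (k + 1) * (c k)⁻¹ ∈ slowMoves (fun _ hβ => h.eqvRc0_mul hβ x) (ε k)) :
    ∃ z : ℕ → ℕ → Λ, ∃ y,
      (∀ k, (∀ j, |θ (z (k + 1)) j - θ (z k) j| ≤ ε k + (1 / 2) ^ k) ∧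
        ∃ J, (∀ j ≥ J, |θ (z k) j - θ x j| ≤ (1 / 2) ^ k) ∧
          ∀ j < J, |θ (z (k + 1)) j - θ (z k) j| ≤ (1 / 2) ^ k) ∧
      Tendsto (fun k => θ (z k)) atTop (𝓝 (θ y)) ∧ ∀ k, ∃ i ≥ k, y i = c k * x i := by
  let Γ (k : ℕ) := {β : ℕ → Λ // ∀ᶠ i in atTop, β i = c k}
  have h_const {k} (β : Γ k) : EventuallyConst β.1 atTop := .of_tendsto (tendsto_pure.2 β.2)
  have h_open (k) (β : Γ k) : {w | ∃ i ≥ k, w i = c k * x i} ∈ 𝓝[C] (β.1 * x) := by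
    obtain ⟨i, hi, hβi⟩ := ((eventually_ge_atTop k).and β.2).exists
    have h_eval : ∀ᶠ w in 𝓝 (β.1 * x), w i = (β.1 * x) i :=
      tendsto_pure.1 (nhds_discrete Λ ▸ (continuous_apply i).tendsto _)
    exact mem_nhdsWithin_of_mem_nhds (h_eval.mono fun w hw => ⟨i, hi, by simp [hw, hβi]⟩)
  obtain ⟨β, y, hR, hyC, h_lim, hy⟩ := exists_tendsto_of_forall_exists_mem_nhds_of_isGδ
    (S := Γ) (z := fun _ β => β.1 * x)
    (R := fun k β β' => (∀ j, |θ (β'.1 * x) j - θ (β.1 * x) j| ≤ ε k + (1 / 2) ^ k) ∧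
      ∃ J, (∀ j ≥ J, |θ (β.1 * x) j - θ x j| ≤ (1 / 2) ^ k) ∧
        ∀ j < J, |θ (β'.1 * x) j - θ (β.1 * x) j| ≤ (1 / 2) ^ k) hx.isGδ
    (fun k β => hx.mul_mem β.1 (h_const β)) h_open
    (fun k β U hU => by
      obtain ⟨J, hJ⟩ := eventually_atTop.1 <| eventually_abs_sub_le_of_eqvRc0
        (h.eqvRc0_mul (h_const β) x) (ε := (1 / 2) ^ k) (by positivity)
      obtain ⟨β', hβ', hU', h_all, h_lt⟩ := hc k ((1 / 2) ^ k) (by positivity) J (c k) β.1 β.2 U hU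
      exact ⟨⟨β', by simpa using hβ'⟩, ⟨h_all, J, hJ, h_lt⟩, hU'⟩)
    ⟨fun _ => c 0, .of_forall fun _ => rfl⟩
  exact ⟨fun k => (β k).1 * x, y, hR, (hx.continuousOn y hyC).tendsto.comp <|
    tendsto_nhdsWithin_iff.2 ⟨h_lim, .of_forall fun k => hx.mul_mem _ (h_const (β k))⟩, hy⟩

/-- Slow moves can be carried out one after the other, converging to a point `y` in the class of
`x`; the ratio of `y` and `x` passes through every `c k`. -/
theorem ReducesVia.exists_tendsto_of_mul_inv_mem_slowMoves (h : ReducesVia φ θ)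
    (hx : IsGenericFor θ S C x) {ε : ℕ → ℚ≥0} (hε : Tendsto (fun k => (ε k : ℝ)) atTop (𝓝 0))
    {c : ℕ → Λ} (hc : ∀ k, c (k + 1) * (c k)⁻¹ ∈ slowMoves (fun _ hβ => h.eqvRc0_mul hβ x) (ε k)) :
    ∃ g, Tendsto (fun k => φ (c k)) atTop (𝓝 g) := by
  obtain ⟨z, y, hz, h_lim, hy⟩ := h.exists_tendsto_slowMoves hx hc
  have h_zero : eqvRc0 (θ y) (θ x) := by
    refine tendsto_zero_of_forall_exists_abs_sub_le (F := fun k j => θ (z k) j - θ x j)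
      (ε := fun k => ε k + (1 / 2) ^ k) (fun j => (tendsto_pi_nhds.1 h_lim j).sub_const _) ?_
      (fun k j => ?_) fun k => ?_
    · simpa using hε.add (tendsto_pow_atTop_nhds_zero_of_lt_one (r := (1 / 2 : ℝ))
        (by norm_num) (by norm_num))
    · simpa using (hz k).1 j
    · simpa using (hz k).2
  obtain ⟨g, hg⟩ := (h y x).2 h_zero
  choose i hi hyi using hy
  refine ⟨g, (hg.comp (tendsto_atTop_mono hi tendsto_id)).congr fun k => ?_⟩
  simp [hyi k]

theorem ReducesVia.exists_slowMoves_subset (h : ReducesVia φ θ) (hx : IsGenericFor θ S C x)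
    {V : Set G} (hV : V ∈ 𝓝 (1 : G)) : ∃ ε : ℚ≥0, 0 < ε ∧
      (slowMoves (fun _ hβ => h.eqvRc0_mul hβ x) ε : Set Λ) ⊆ φ ⁻¹' V := by
  by_contra! h_not
  choose a ha haV using fun k : ℕ =>
    Set.not_subset.1 (h_not (1 / (k + 1)) (by positivity))
  let c (k : ℕ) : Λ := Nat.rec 1 (fun k c => a k * c) k
  have hc (k) : c (k + 1) * (c k)⁻¹ = a k := mul_inv_cancel_right _ _
  obtain ⟨g, hg⟩ := h.exists_tendsto_of_mul_inv_mem_slowMoves hx (c := c)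
    (ε := fun k => 1 / (k + 1)) (by simpa using tendsto_one_div_add_atTop_nhds_zero_nat (𝕜 := ℝ))
    fun k => (hc k).symm ▸ ha k
  have h_one : Tendsto (fun k => φ (a k)) atTop (𝓝 1) := by
    simpa [← map_inv, ← map_mul, hc] using (hg.comp (tendsto_add_atTop_nat 1)).mul hg.inv
  obtain ⟨k, hk⟩ := (h_one.eventually_mem hV).exists
  exact haV k hk

end SlowMovesConvergence

theorem BorelReducible.exists_normalClosure_preimage_subset {G : Type*} [Group G]
    [TopologicalSpace G] [IsTopologicalGroup G] [FirstCountableTopology G]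
    (h : BorelReducible (eqvGroup G) eqvRc0) {Λ : Type*} [Group Λ] [Countable Λ] (φ : Λ →* G)
    {V : Set G} (hV : V ∈ 𝓝 (1 : G)) :
    ∃ U ∈ 𝓝 (1 : G), (Subgroup.normalClosure (φ ⁻¹' U) : Set Λ) ⊆ φ ⁻¹' V := by
  let _ : TopologicalSpace Λ := ⊥
  have : DiscreteTopology Λ := ⟨rfl⟩
  obtain ⟨f, f_meas, hf⟩ := h
  have h_cont : Continuous fun x : ℕ → Λ => φ ∘ x :=
    continuous_pi fun n => continuous_of_discreteTopology.comp (continuous_apply n)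
  have h_red : ReducesVia φ fun x => f (φ ∘ x) := fun x y => hf _ _
  obtain ⟨T, hT⟩ := (𝓝 (1 : G)).exists_antitone_basis
  obtain ⟨C, x, hx⟩ := exists_isGenericFor
    (f_meas.comp (measurable_borel_of_continuous h_cont)) fun n => φ ⁻¹' T n
  obtain ⟨ε, hε, h_slow⟩ := h_red.exists_slowMoves_subset hx hV
  obtain ⟨U, hU, h_le⟩ := h_red.exists_normalClosure_le_slowMoves hT hx hε
  exact ⟨U, hU, fun a ha => h_slow (h_le ha)⟩

theorem exists_finite_mem_map_normalClosure {G : Type*} [Group G] {T : Set G} {g : G}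
    (hg : g ∈ Subgroup.normalClosure T) :
    ∃ F : Set G, F.Finite ∧ ∀ H : Subgroup G, F ⊆ H →
      g ∈ (Subgroup.normalClosure (H.subtype ⁻¹' T)).map H.subtype := by
  induction hg using Subgroup.closure_induction with
  | mem y hy =>
    obtain ⟨t, ht, hty⟩ := Group.mem_conjugatesOfSet_iff.1 hy
    obtain ⟨c, rfl⟩ := isConj_iff.1 hty
    refine ⟨{c, t}, Set.toFinite _, fun H hH => ?_⟩
    let c' : H := ⟨c, hH (by simp)⟩
    let t' : H := ⟨t, hH (by simp)⟩
    have ht' : t' ∈ Subgroup.normalClosure (H.subtype ⁻¹' T) := Subgroup.subset_normalClosure ht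
    exact ⟨c' * t' * c'⁻¹, Subgroup.normalClosure_normal.conj_mem t' ht' c', rfl⟩
  | one => exact ⟨∅, Set.finite_empty, fun H _ => one_mem _⟩
  | mul y z _ _ ihy ihz =>
    obtain ⟨Fy, hFy, hy⟩ := ihy
    obtain ⟨Fz, hFz, hz⟩ := ihz
    exact ⟨Fy ∪ Fz, hFy.union hFz, fun H hH =>
      mul_mem (hy H (Set.subset_union_left.trans hH)) (hz H (Set.subset_union_right.trans hH))⟩
  | inv y _ ih =>
    obtain ⟨F, hF, hy⟩ := ih
    exact ⟨F, hF, fun H hH => inv_mem (hy H hH)⟩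

theorem countable_closure {G : Type*} [Group G] {A : Set G} (hA : A.Countable) :
    Countable (Subgroup.closure A) := by
  have := hA.to_subtype
  rw [FreeGroup.closure_eq_range]
  exact (Set.countable_range (FreeGroup.lift ((↑) : A → G))).to_subtype

/-- If the property failed at `V`, the failure would already be visible in the countable subgroup
generated by the elements witnessing it along a countable neighbourhood basis. -/
theorem hasOpenNormalBasis_of_borelReducible_eqvRc0 {G : Type*} [Group G] [TopologicalSpace G]
    [IsTopologicalGroup G] [FirstCountableTopology G] (h : BorelReducible (eqvGroup G) eqvRc0) :
    HasOpenNormalBasis G := by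
  refine .of_normalClosure_subset ?_
  by_contra! ⟨V, hV, h_not⟩
  obtain ⟨T, hT⟩ := (𝓝 (1 : G)).exists_antitone_basis
  choose g hg hgV using fun n => Set.not_subset.1 (h_not (T n) (hT.1.mem_of_mem trivial))
  choose F hF hgF using fun n => exists_finite_mem_map_normalClosure (hg n)
  let H : Subgroup G := Subgroup.closure (⋃ n, F n)
  have : Countable H := countable_closure (Set.countable_iUnion fun n => (hF n).countable)
  obtain ⟨U, hU, hUV⟩ := h.exists_normalClosure_preimage_subset H.subtype hV
  obtain ⟨n, -, hn⟩ := hT.1.mem_iff.1 hU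
  obtain ⟨a, ha, hag⟩ := hgF n H ((Set.subset_iUnion F n).trans Subgroup.subset_closure)
  exact hgV n (hag ▸ hUV (Subgroup.normalClosure_mono (Set.preimage_mono hn) ha))

theorem mainTheorem2 (G : Type*) [Group G] [TopologicalSpace G] [IsTopologicalGroup G]
    [PolishSpace G] :
    List.TFAE [
      IsTSI G ∧ NonarchimedeanGroup G,
      BorelReducible (eqvGroup G) (eqvOmega eqvE0),
      BorelReducible (eqvGroup G) eqvRc0] ∧
    (BorelBireducible (eqvGroup G) (eqvOmega eqvE0) ↔
      IsTSI G ∧ Uncountable G ∧ NonarchimedeanGroup G) ∧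
    ¬ (StrictlyBorelReducible (eqvOmega eqvE0) (eqvGroup G) ∧
      BorelReducible (eqvGroup G) eqvRc0) := by
  have h12 : IsTSI G ∧ NonarchimedeanGroup G → BorelReducible (eqvGroup G) (eqvOmega eqvE0) :=
    fun h => (hasOpenNormalBasis_iff.2 h).borelReducible_eqvOmega_eqvE0
  have h23 : BorelReducible (eqvGroup G) (eqvOmega eqvE0) → BorelReducible (eqvGroup G) eqvRc0 :=
    fun h => h.trans borelReducible_eqvOmega_eqvE0_eqvRc0
  have h31 : BorelReducible (eqvGroup G) eqvRc0 → IsTSI G ∧ NonarchimedeanGroup G :=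
    fun h => hasOpenNormalBasis_iff.1 (hasOpenNormalBasis_of_borelReducible_eqvRc0 h)
  refine ⟨?_, ⟨fun ⟨h_le, h_ge⟩ => ?_, fun ⟨h_tsi, _, h_nonarch⟩ => ?_⟩,
    fun h => h.1.2 (h12 (h31 h.2))⟩
  · tfae_have 1 → 2 := h12
    tfae_have 2 → 3 := h23
    tfae_have 3 → 1 := h31
    tfae_finish
  · obtain ⟨h_tsi, h_nonarch⟩ := h31 (h23 h_le)
    refine ⟨h_tsi, not_countable_iff.1 fun _ => ?_, h_nonarch⟩
    exact not_borelReducible_eqvOmega_eqvE0_eqvGroup_of_countable h_ge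
  · exact ⟨h12 ⟨h_tsi, h_nonarch⟩, borelReducible_eqvOmega_eqvE0_eqvGroup_of_uncountable⟩
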